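/- Let $\Gamma$ be a connected metric graph, formed by finitely many (at least one) compact edges $E_n=[x_{2n-1},x_{2n}]$ of positive length whose endpoints are joined together at vertices (each vertex is a nonempty class of endpoints; loops and multiple edges are allowed). The standard Laplacian $L^{\mathrm{st}}(\Gamma)=-\frac{d^2}{dx^2}$ acts in $L_2(\Gamma)=\bigoplus_n L_2(E_n)$ on the functions $u\in\bigoplus_n W_2^2(E_n)$ that are continuous at every vertex and for which, at every vertex, the sum of the normal derivatives is zero. Let $\lambda_0(\Gamma)=0\le\lambda_1(\Gamma)\le\lambda_2(\Gamma)\le\dots$ be its eigenvalues, counted with multiplicity; the spectral gap is $\lambda_1(\Gamma)-\lambda_0(\Gamma)=\lambda_1(\Gamma)$. Let $\Gamma'$ be the metric graph obtained from $\Gamma$ by joining two of its vertices $V_1$ and $V_2$ into one vertex, the edges being unchanged. Then: 1. The spectral gap satisfies $\lambda_1(\Gamma)\le\lambda_1(\Gamma')$. 2. The equality $\lambda_1(\Gamma)=\lambda_1(\Gamma')$ holds if and only if there is an eigenfunction $\psi_1$ of $L^{\mathrm{st}}(\Gamma)$ with eigenvalue $\lambda_1(\Gamma)$ such that $\psi_1(V_1)=\psi_1(V_2)$.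 -/

import Mathlib

open MeasureTheory Set

noncomputable section

/-- A metric graph with compact edges. The edge `e` is the interval `[left e, right e]` of positive
length; `(e, false)` and `(e, true)` are its left and right endpoints. The vertices are the
classes into which the endpoints are joined: `vertex p` is the vertex to which the endpoint `p`
belongs, and every vertex contains at least one endpoint. Loops and multiple edges are allowed. -/
structure MetricGraph (V E : Type*) where
  left : E → ℝ
  right : E → ℝ
  left_lt_right : ∀ e, left e < right e
  vertex : E × Bool → V
  vertex_surjective : Function.Surjective vertex

/-- `f` is (the continuous representative of) a function in the Sobolev space `W₂¹(a, b)` with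
derivative `g ∈ L₂(a, b)`. -/
def HasSobolevDeriv {𝕜 : Type*} [RCLike 𝕜] (a b : ℝ) (f g : ℝ → 𝕜) : Prop :=
  MemLp g 2 (volume.restrict (Icc a b)) ∧ ∀ x ∈ Icc a b, f x = f a + ∫ t in a..x, g t

namespace MetricGraph

/-- The graph is nonempty and any two of its vertices are joined by a chain of edges. -/
def Connected {V E : Type*} (Γ : MetricGraph V E) : Prop :=
  Nonempty V ∧
    ∀ v w : V, Relation.EqvGen (fun x y => ∃ e, Γ.vertex (e, false) = x ∧ Γ.vertex (e, true) = y) v w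

/-- The metric graph obtained by joining the vertices `v` and `w` into one vertex; the edges are
unchanged. -/
def glue {V E : Type*} (Γ : MetricGraph V E) (v w : V) :
    MetricGraph (Quot (fun x y : V => x = v ∧ y = w)) E where
  left := Γ.left
  right := Γ.right
  left_lt_right := Γ.left_lt_right
  vertex p := Quot.mk _ (Γ.vertex p)
  vertex_surjective := Quot.mk_surjective.comp Γ.vertex_surjective

/-- The points of the edges. -/
abbrev Point {V E : Type*} (Γ : MetricGraph V E) : Type _ :=
  Σ e : E, Icc (Γ.left e) (Γ.right e)

/-- A function on the graph is given by a family `u e : ℝ → 𝕜`, of which only the values on the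
edges matter: this is the function on the edges that it defines. -/
def restrict {V E 𝕜 : Type*} (Γ : MetricGraph V E) (u : E → ℝ → 𝕜) : Γ.Point → 𝕜 :=
  fun p => u p.1 p.2

/-- The coordinate of an endpoint on its edge. -/
def coord {V E : Type*} (Γ : MetricGraph V E) (p : E × Bool) : ℝ :=
  if p.2 then Γ.right p.1 else Γ.left p.1

/-- The limit value of `u` at an endpoint. -/
def endValue {V E 𝕜 : Type*} (Γ : MetricGraph V E) (u : E → ℝ → 𝕜) (p : E × Bool) : 𝕜 :=
  u p.1 (Γ.coord p)

/-- The derivative at an endpoint along the normal pointing into the edge, for a function with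
derivative `u'`. -/
def normalDeriv {V E 𝕜 : Type*} [RCLike 𝕜] (Γ : MetricGraph V E) (u' : E → ℝ → 𝕜)
    (p : E × Bool) : 𝕜 :=
  if p.2 then -Γ.endValue u' p else Γ.endValue u' p

/-- `u` is continuous at all vertices. -/
def ContinuousAtVertices {V E 𝕜 : Type*} (Γ : MetricGraph V E) (u : E → ℝ → 𝕜) : Prop :=
  ∀ p q, Γ.vertex p = Γ.vertex q → Γ.endValue u p = Γ.endValue u q

/-- The value of `u` at a vertex. -/
def vertexValue {V E 𝕜 : Type*} (Γ : MetricGraph V E) (u : E → ℝ → 𝕜) (v : V) : 𝕜 :=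
  Γ.endValue u (Function.surjInv Γ.vertex_surjective v)

theorem vertexValue_vertex {V E 𝕜 : Type*} (Γ : MetricGraph V E) (u : E → ℝ → 𝕜)
    (hu : Γ.ContinuousAtVertices u) (p : E × Bool) :
    Γ.vertexValue u (Γ.vertex p) = Γ.endValue u p :=
  hu _ _ (Function.surjInv_eq Γ.vertex_surjective _)

open Classical in
/-- `u` belongs to the domain of the standard Laplacian of the graph, and its first and second
derivatives are `u'` and `u''`: on every edge `u` is in `W₂²`, and at every vertex `u` is
continuous and the sum of its normal derivatives is zero. -/
structure InDomain {V E 𝕜 : Type*} [RCLike 𝕜] [Fintype E] (Γ : MetricGraph V E)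
    (u u' u'' : E → ℝ → 𝕜) : Prop where
  deriv_one : ∀ e, HasSobolevDeriv (Γ.left e) (Γ.right e) (u e) (u' e)
  deriv_two : ∀ e, HasSobolevDeriv (Γ.left e) (Γ.right e) (u' e) (u'' e)
  continuousAtVertices : Γ.ContinuousAtVertices u
  sum_normalDeriv : ∀ v : V, ∑ p : E × Bool with Γ.vertex p = v, Γ.normalDeriv u' p = 0

/-- `u` is an eigenfunction of the standard Laplacian `-d²/dx²` with eigenvalue `μ`. -/
def IsEigenfunction {V E 𝕜 : Type*} [RCLike 𝕜] [Fintype E] (Γ : MetricGraph V E) (μ : ℝ)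
    (u : E → ℝ → 𝕜) : Prop :=
  Γ.restrict u ≠ 0 ∧ ∃ u' u'' : E → ℝ → 𝕜, Γ.InDomain u u' u'' ∧
    ∀ e, ∀ᵐ x ∂volume.restrict (Icc (Γ.left e) (Γ.right e)), -u'' e x = (μ : 𝕜) * u e x

/-- The real numbers `t` such that the standard Laplacian has at least `n` eigenvalues, counted
with multiplicity, in `(-∞, t]`. -/
def levels (𝕜 : Type*) [RCLike 𝕜] {V E : Type*} [Fintype E] (Γ : MetricGraph V E) (n : ℕ) :
    Set ℝ :=
  {t | ∃ u : Fin n → E → ℝ → 𝕜, LinearIndependent 𝕜 (fun i => Γ.restrict (u i)) ∧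
    ∀ i, ∃ μ ≤ t, Γ.IsEigenfunction μ (u i)}

/-- The eigenvalues `λ₀ ≤ λ₁ ≤ …` of the standard Laplacian, in increasing order and repeated
according to multiplicity: `λₖ` is the least `t` such that at least `k + 1` eigenvalues are `≤ t`. -/
def eigenvalue (𝕜 : Type*) [RCLike 𝕜] {V E : Type*} [Fintype E] (Γ : MetricGraph V E) (k : ℕ) :
    ℝ :=
  sInf (Γ.levels 𝕜 (k + 1))

/-- The spectral gap `λ₁ - λ₀`. -/
def spectralGap (𝕜 : Type*) [RCLike 𝕜] {V E : Type*} [Fintype E] (Γ : MetricGraph V E) : ℝ :=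
  Γ.eigenvalue 𝕜 1 - Γ.eigenvalue 𝕜 0

end MetricGraph

end

/-! For a connected graph, `λ₁` is the minimum of the Rayleigh quotient `‖u'‖² / ‖u‖²` over nonzero
functions `u` of mean zero in the form domain: `W₂¹` on every edge, continuous at the vertices, no
condition on normal derivatives. Joining `V₁` and `V₂` leaves the norms and the mean unchanged and
only adds the constraint `u(V₁) = u(V₂)` (`inFormDomain_glue_iff`). A minimum over a smaller set
cannot be smaller, which is the inequality. If the minima agree, a minimizer for the joined graph
also minimizes on `Γ`, so it is an eigenfunction of `Γ`, and it takes equal values at `V₁` and `V₂`.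
Conversely, an eigenfunction for `λ₁(Γ)` with equal values competes on the joined graph and gives
the reverse inequality.

The minimum exists by compactness (`exists_rayleigh_minimum`). The derivatives of form domain
functions make up a closed subspace of `L₂(Γ)`, and the operator `T` from a derivative to its
primitive of mean zero is compact, being built from Volterra operators and finite rank corrections.
A compact operator attains its norm, and the minimum is `‖T‖⁻²`. A vector where the norm is attained
satisfies `T*T x = ‖T‖² x`, which is the weak eigenvalue equation. `isEigenfunction_iff` shows that
the weak equation is equivalent to the differential equation with the vertex conditions, and
`isLeast_levels_two` identifies the minimum with the second eigenvalue. -/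

noncomputable section

/-! ### Compact operators attain their norm -/

section CompactOperators

variable {𝕜 H F : Type*} [RCLike 𝕜] [NormedAddCommGroup H] [InnerProductSpace 𝕜 H]
  [CompleteSpace H] [NormedAddCommGroup F] [InnerProductSpace 𝕜 F] [CompleteSpace F]

-- `T*T` is self-adjoint, so its spectral radius is its norm `‖T‖²`, and some spectral value has
-- this modulus. It is nonzero, hence an eigenvalue by compactness, and `T` attains its norm at an
-- eigenvector.
open ContinuousLinearMap in
theorem IsCompactOperator.exists_norm_eq_one_norm_apply_eq {T : H →L[𝕜] F}
    (hT : IsCompactOperator T) (h0 : T ≠ 0) : ∃ x, ‖x‖ = 1 ∧ ‖T x‖ = ‖T‖ := by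
  set S : H →L[𝕜] H := adjoint T ∘L T with hS
  have hSc : IsCompactOperator S := hT.clm_comp (adjoint T)
  have hSa : IsSelfAdjoint S := by
    rw [isSelfAdjoint_iff', hS, adjoint_comp, adjoint_adjoint]
  have hSn : ‖S‖ = ‖T‖ * ‖T‖ := norm_adjoint_comp_self T
  have hTn : 0 < ‖T‖ := norm_pos_iff.mpr h0
  have hr := S.spectralRadius_eq_nnnorm hSa
  have hne : (spectrum 𝕜 S).Nonempty := by
    by_contra h
    rw [not_nonempty_iff_eq_empty] at h
    have h1 : (‖S‖₊ : ENNReal) = 0 := by rw [← hr, spectralRadius, h]; simp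
    have h2 : ‖S‖ = 0 := by simpa using h1
    rw [hSn] at h2
    nlinarith
  obtain ⟨k, hk, hkr⟩ := spectrum.exists_nnnorm_eq_spectralRadius_of_nonempty hne
  rw [hr] at hkr
  have hkn : ‖k‖ = ‖T‖ * ‖T‖ := by
    rw [← hSn, ← coe_nnnorm, ← coe_nnnorm]; exact_mod_cast hkr
  have hk0 : k ≠ 0 := by
    rintro rfl
    rw [norm_zero] at hkn
    nlinarith
  obtain ⟨v, hv⟩ := ((hSc.hasEigenvalue_iff_mem_spectrum hk0).mpr hk).exists_hasEigenvector
  have hv1 : S v = k • v := hv.apply_eq_smul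
  have hv0 : 0 < ‖v‖ := norm_pos_iff.mpr hv.2
  have h1 : ‖T v‖ ^ 2 = ‖k‖ * ‖v‖ ^ 2 := by
    have h2 : inner 𝕜 (S v) v = inner 𝕜 (T v) (T v) := by
      rw [hS, comp_apply, adjoint_inner_left]
    have h3 := congrArg norm h2
    rw [hv1, inner_smul_left, inner_self_eq_norm_sq_to_K, inner_self_eq_norm_sq_to_K] at h3
    simpa using h3.symm
  have h2 : ‖T v‖ = ‖T‖ * ‖v‖ := by
    have : ‖T v‖ ^ 2 = (‖T‖ * ‖v‖) ^ 2 := by rw [h1, hkn]; ring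
    exact (pow_left_inj₀ (norm_nonneg _) (by positivity) two_ne_zero).mp this
  refine ⟨((‖v‖⁻¹ : ℝ) : 𝕜) • v, ?_, ?_⟩
  · rw [norm_smul]; simp [hv0.ne']
  · rw [map_smul, norm_smul, h2]; simp; field_simp

-- The Euler–Lagrange equation of norm maximization: expanding `‖T*T x - ‖T‖² x‖²` and bounding
-- `‖T*T x‖` by `‖T‖² ‖x‖` shows that it is at most zero.
open ContinuousLinearMap in
theorem ContinuousLinearMap.inner_apply_apply_of_norm_apply_eq {T : H →L[𝕜] F} {x : H}
    (hx : ‖T x‖ = ‖T‖ * ‖x‖) (y : H) :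
    inner 𝕜 (T x) (T y) = ((‖T‖ ^ 2 : ℝ) : 𝕜) * inner 𝕜 x y := by
  set S : H →L[𝕜] H := adjoint T ∘L T with hS
  have hSn : ‖S‖ = ‖T‖ * ‖T‖ := norm_adjoint_comp_self T
  have key : S x = ((‖T‖ ^ 2 : ℝ) : 𝕜) • x := by
    rw [← sub_eq_zero, ← norm_eq_zero, ← sq_eq_zero_iff]
    refine le_antisymm ?_ (sq_nonneg _)
    rw [@norm_sub_sq 𝕜, inner_smul_right, norm_smul, hS, comp_apply, adjoint_inner_left,
      inner_self_eq_norm_sq_to_K, ← comp_apply, ← hS]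
    have h1 : ‖S x‖ ≤ ‖T‖ * ‖T‖ * ‖x‖ := hSn ▸ S.le_opNorm x
    have h2 : ‖S x‖ ^ 2 ≤ (‖T‖ * ‖T‖ * ‖x‖) ^ 2 := by gcongr
    rw [hx]
    norm_cast
    rw [abs_of_nonneg (by positivity)]
    nlinarith
  rw [← adjoint_inner_left, ← comp_apply, ← hS, key, inner_smul_left, RCLike.conj_ofReal]

end CompactOperators

/-! ### Calculus in `W₂¹` of an interval -/

section Sobolev

variable {𝕜 : Type*} [RCLike 𝕜] {a b : ℝ} {f f' g g' : ℝ → 𝕜}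

theorem AbsolutelyContinuousOnInterval.congr {X : Type*} [PseudoMetricSpace X] {f g : ℝ → X}
    (hf : AbsolutelyContinuousOnInterval f a b) (h : EqOn f g (uIcc a b)) :
    AbsolutelyContinuousOnInterval g a b := by
  rw [absolutelyContinuousOnInterval_iff] at hf ⊢
  intro ε hε
  obtain ⟨δ, hδ, H⟩ := hf ε hε
  refine ⟨δ, hδ, fun E hE hlt => ?_⟩
  have := H E hE hlt
  convert! this using 2 with i hi
  have hi' := hE.1 i hi
  rw [h hi'.1, h hi'.2]

theorem AbsolutelyContinuousOnInterval.const {X : Type*} [PseudoMetricSpace X] (c : X) :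
    AbsolutelyContinuousOnInterval (fun _ => c) a b :=
  LipschitzOnWith.absolutelyContinuousOnInterval (K := 0) (LipschitzWith.const c).lipschitzOnWith

theorem IntervalIntegrable.absolutelyContinuousOnInterval_integral_rclike
    (h : IntervalIntegrable f volume a b) :
    AbsolutelyContinuousOnInterval (fun x => ∫ t in a..x, f t) a b := by
  have hre : IntervalIntegrable (fun t => RCLike.re (f t)) volume a b :=
    ⟨h.1.re, h.2.re⟩
  have him : IntervalIntegrable (fun t => RCLike.im (f t)) volume a b :=
    ⟨h.1.im, h.2.im⟩
  have h1 := (hre.absolutelyContinuousOnInterval_intervalIntegral (c := a) (by simp)).smul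
    (AbsolutelyContinuousOnInterval.const (1 : 𝕜))
  have h2 := (him.absolutelyContinuousOnInterval_intervalIntegral (c := a) (by simp)).smul
    (AbsolutelyContinuousOnInterval.const (RCLike.I : 𝕜))
  refine (h1.add h2).congr fun x hx => ?_
  have hx' : IntervalIntegrable f volume a x := h.mono_set (uIcc_subset_uIcc_left hx)
  have hre' : IntervalIntegrable (fun t => RCLike.re (f t)) volume a x :=
    ⟨hx'.1.re, hx'.2.re⟩
  have him' : IntervalIntegrable (fun t => RCLike.im (f t)) volume a x :=
    ⟨hx'.1.im, hx'.2.im⟩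
  simp only [Pi.add_apply, Pi.smul_apply', ← intervalIntegral.integral_smul_const]
  rw [← intervalIntegral.integral_add]
  · refine intervalIntegral.integral_congr fun t _ => ?_
    simp [RCLike.real_smul_eq_coe_mul, RCLike.re_add_im]
  · exact ⟨hre'.1.smul_const _, hre'.2.smul_const _⟩
  · exact ⟨him'.1.smul_const _, him'.2.smul_const _⟩

namespace HasSobolevDeriv

theorem integrableOn (h : HasSobolevDeriv a b f f') : IntegrableOn f' (Icc a b) :=
  h.1.integrable one_le_two

theorem intervalIntegrable (h : HasSobolevDeriv a b f f') {x y : ℝ} (hx : x ∈ Icc a b)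
    (hy : y ∈ Icc a b) : IntervalIntegrable f' volume x y :=
  (h.integrableOn.mono_set (uIcc_subset_Icc hx hy)).intervalIntegrable

theorem absolutelyContinuousOnInterval (hab : a ≤ b) (h : HasSobolevDeriv a b f f') :
    AbsolutelyContinuousOnInterval f a b := by
  have h1 := h.intervalIntegrable (left_mem_Icc.mpr hab) (right_mem_Icc.mpr hab)
  refine ((AbsolutelyContinuousOnInterval.const (f a)).add
    h1.absolutelyContinuousOnInterval_integral_rclike).congr fun x hx => ?_
  rw [uIcc_of_le hab] at hx
  exact (h.2 x hx).symm

theorem continuousOn (hab : a ≤ b) (h : HasSobolevDeriv a b f f') : ContinuousOn f (Icc a b) := by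
  simpa [uIcc_of_le hab] using (h.absolutelyContinuousOnInterval hab).continuousOn

theorem ae_hasDerivAt (hab : a ≤ b) (h : HasSobolevDeriv a b f f') :
    ∀ᵐ x, x ∈ uIcc a b → HasDerivAt f (f' x) x := by
  have h1 := h.intervalIntegrable (left_mem_Icc.mpr hab) (right_mem_Icc.mpr hab)
  have ha : ∀ᵐ x : ℝ, x ≠ a := by simp [ae_iff, measure_singleton]
  have hb : ∀ᵐ x : ℝ, x ≠ b := by simp [ae_iff, measure_singleton]
  filter_upwards [h1.ae_hasDerivAt_integral, ha, hb] with x hx hxa hxb hxm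
  have h2 := (hx hxm a (by simp)).const_add (f a)
  rw [uIcc_of_le hab] at hxm
  refine h2.congr_of_eventuallyEq ?_
  filter_upwards [Icc_mem_nhds (lt_of_le_of_ne hxm.1 hxa.symm) (lt_of_le_of_ne hxm.2 hxb)]
    with y hy using h.2 y hy

theorem memLp (hab : a ≤ b) (h : HasSobolevDeriv a b f f') :
    MemLp f 2 (volume.restrict (Icc a b)) := by
  obtain ⟨C, hC⟩ := isCompact_Icc.exists_bound_of_continuousOn (h.continuousOn hab)
  refine MemLp.of_bound ((h.continuousOn hab).aestronglyMeasurable measurableSet_Icc) C ?_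
  exact (ae_restrict_mem measurableSet_Icc).mono hC

theorem congr_deriv (h : HasSobolevDeriv a b f f') (hg : f' =ᵐ[volume.restrict (Icc a b)] g') :
    HasSobolevDeriv a b f g' := by
  refine ⟨h.1.ae_eq hg, fun x hx => ?_⟩
  rw [h.2 x hx]
  congr 1
  refine intervalIntegral.integral_congr_ae ?_
  rw [uIoc_of_le hx.1, ← ae_restrict_iff' measurableSet_Ioc]
  exact ae_restrict_of_ae_restrict_of_subset
    (Ioc_subset_Icc_self.trans (Icc_subset_Icc_right hx.2)) hg

theorem primitive (hf : MemLp f' 2 (volume.restrict (Icc a b))) (c : 𝕜) :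
    HasSobolevDeriv a b (fun x => c + ∫ t in a..x, f' t) f' :=
  ⟨hf, fun x _ => by simp⟩

theorem const (c : 𝕜) : HasSobolevDeriv a b (fun _ => c) (fun _ => 0) :=
  ⟨MemLp.zero', fun x _ => by simp⟩

theorem add (hf : HasSobolevDeriv a b f f') (hg : HasSobolevDeriv a b g g') :
    HasSobolevDeriv a b (fun x => f x + g x) (fun x => f' x + g' x) := by
  refine ⟨hf.1.add hg.1, fun x hx => ?_⟩
  have ha : a ∈ Icc a b := ⟨le_rfl, hx.1.trans hx.2⟩
  beta_reduce
  rw [intervalIntegral.integral_add (hf.intervalIntegrable ha hx) (hg.intervalIntegrable ha hx),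
    hf.2 x hx, hg.2 x hx]
  ring

theorem const_mul (c : 𝕜) (hf : HasSobolevDeriv a b f f') :
    HasSobolevDeriv a b (fun x => c * f x) (fun x => c * f' x) := by
  refine ⟨hf.1.const_mul c, fun x hx => ?_⟩
  beta_reduce
  rw [intervalIntegral.integral_const_mul, hf.2 x hx]
  ring

theorem sub_const (hf : HasSobolevDeriv a b f f') (c : 𝕜) :
    HasSobolevDeriv a b (fun x => f x - c) f' :=
  ⟨hf.1, fun x hx => by beta_reduce; rw [hf.2 x hx]; ring⟩

theorem conj (hf : HasSobolevDeriv a b f f') :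
    HasSobolevDeriv a b (fun x => starRingEnd 𝕜 (f x)) (fun x => starRingEnd 𝕜 (f' x)) := by
  refine ⟨hf.1.star, fun x hx => ?_⟩
  beta_reduce
  rw [hf.2 x hx, map_add]
  simp only [intervalIntegral.integral_of_le hx.1, integral_conj]

/-- Integration by parts: `f g` minus the primitive of `f' g + f g'` is absolutely continuous with
derivative zero almost everywhere, hence constant. -/
theorem integral_deriv_mul_add (hab : a ≤ b) (hf : HasSobolevDeriv a b f f')
    (hg : HasSobolevDeriv a b g g') :
    (∫ x in Icc a b, f' x * g x) + ∫ x in Icc a b, f x * g' x = f b * g b - f a * g a := by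
  have hi1 : IntegrableOn (fun x => f' x * g x) (Icc a b) := hf.1.integrable_mul (hg.memLp hab)
  have hi2 : IntegrableOn (fun x => f x * g' x) (Icc a b) := (hf.memLp hab).integrable_mul hg.1
  have hi : IntervalIntegrable (fun x => f' x * g x + f x * g' x) volume a b := by
    rw [intervalIntegrable_iff_integrableOn_Icc_of_le hab]
    exact hi1.add hi2
  have hP : AbsolutelyContinuousOnInterval
      (fun x => f x * g x - ∫ t in a..x, (f' t * g t + f t * g' t)) a b := by
    have h1 : AbsolutelyContinuousOnInterval (fun x => f x • g x) a b :=
      (hf.absolutelyContinuousOnInterval hab).fun_smul (hg.absolutelyContinuousOnInterval hab)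
    exact h1.fun_sub hi.absolutelyContinuousOnInterval_integral_rclike
  have h0 : ∀ᵐ x, x ∈ uIcc a b →
      HasDerivAt (fun x => f x * g x - ∫ t in a..x, (f' t * g t + f t * g' t)) 0 x := by
    filter_upwards [hf.ae_hasDerivAt hab, hg.ae_hasDerivAt hab, hi.ae_hasDerivAt_integral]
      with x h1 h2 h3 hx
    simpa only [sub_self] using ((h1 hx).fun_mul (h2 hx)).fun_sub (h3 hx a (by simp))
  obtain ⟨C, hC⟩ := hP.const_of_ae_hasDerivAt_zero h0
  have ha := hC a (by simp)
  have hb := hC b (by simp)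
  simp only [intervalIntegral.integral_same, sub_zero] at ha hb
  rw [← integral_add hi1 hi2, integral_Icc_eq_integral_Ioc, ← intervalIntegral.integral_of_le hab,
    ha, ← hb]
  ring

end HasSobolevDeriv

end Sobolev

/-! ### Compactness of the Volterra operator -/

section Volterra

variable {𝕜 : Type*} [RCLike 𝕜] {a b : ℝ}

theorem restrict_Icc_Ioc_of_mem {x y : ℝ} (hx : x ∈ Icc a b) (hy : y ∈ Icc a b) :
    (volume.restrict (Icc a b)).restrict (Ioc x y) = volume.restrict (Ioc x y) :=
  Measure.restrict_restrict_of_subset (Ioc_subset_Icc_self.trans (Icc_subset_Icc hx.1 hy.2))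

/-- Integration over a subinterval as a continuous linear functional on `L₂(a, b)`. -/
def integralL2 (𝕜 : Type*) [RCLike 𝕜] (a b x y : ℝ) :
    Lp 𝕜 2 (volume.restrict (Icc a b)) →L[𝕜] 𝕜 :=
  innerSL 𝕜 (indicatorConstLp 2 (measurableSet_Ioc (a := x) (b := y)) (measure_ne_top _ _) (1 : 𝕜))

theorem integralL2_apply {x y : ℝ} (hx : x ∈ Icc a b) (hy : y ∈ Icc a b) (hxy : x ≤ y)
    (g : Lp 𝕜 2 (volume.restrict (Icc a b))) :
    integralL2 𝕜 a b x y g = ∫ t in x..y, g t := by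
  rw [integralL2, innerSL_apply_apply, L2.inner_indicatorConstLp_one,
    restrict_Icc_Ioc_of_mem hx hy, intervalIntegral.integral_of_le hxy]

/-- Cauchy–Schwarz against the indicator function of `(x, y]`. -/
theorem norm_integral_le_sqrt_mul_norm {x y : ℝ} (hx : x ∈ Icc a b) (hy : y ∈ Icc a b)
    (hxy : x ≤ y) (g : Lp 𝕜 2 (volume.restrict (Icc a b))) :
    ‖∫ t in x..y, g t‖ ≤ √(y - x) * ‖g‖ := by
  rw [← integralL2_apply hx hy hxy, integralL2, innerSL_apply_apply]
  refine (norm_inner_le_norm _ _).trans ?_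
  gcongr
  rw [norm_indicatorConstLp (by norm_num) (by norm_num), norm_one, one_mul, measureReal_def,
    Measure.restrict_apply measurableSet_Ioc,
    inter_eq_left.mpr (Ioc_subset_Icc_self.trans (Icc_subset_Icc hx.1 hy.2)), Real.volume_Ioc,
    ENNReal.toReal_ofReal (by linarith), Real.sqrt_eq_rpow]
  simp

theorem Lp.memLp_integral (hab : a ≤ b) (g : Lp 𝕜 2 (volume.restrict (Icc a b))) :
    MemLp (fun x => ∫ t in a..x, g t) 2 (volume.restrict (Icc a b)) := by
  simpa using (HasSobolevDeriv.primitive (Lp.memLp g) 0).memLp hab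

theorem Lp.norm_le_of_ae_norm_le (hab : a ≤ b) (g : Lp 𝕜 2 (volume.restrict (Icc a b)))
    {C : ℝ} (hC : 0 ≤ C) (h : ∀ᵐ x ∂volume.restrict (Icc a b), ‖g x‖ ≤ C) :
    ‖g‖ ≤ √(b - a) * C := by
  refine (Lp.norm_le_of_ae_bound hC h).trans (le_of_eq ?_)
  congr 1
  rw [Real.sqrt_eq_rpow]
  simp [measureUnivNNReal, ENNReal.ofReal, hab]

/-- The Volterra operator `g ↦ (x ↦ ∫ t in a..x, g t)` on `L₂(a, b)`. -/
def volterra (𝕜 : Type*) [RCLike 𝕜] {a b : ℝ} (hab : a ≤ b) :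
    Lp 𝕜 2 (volume.restrict (Icc a b)) →L[𝕜] Lp 𝕜 2 (volume.restrict (Icc a b)) :=
  LinearMap.mkContinuous
    { toFun := fun g => (Lp.memLp_integral hab g).toLp
      map_add' := fun f g => by
        rw [← MemLp.toLp_add]
        refine MemLp.toLp_congr _ _ ?_
        refine (ae_restrict_mem measurableSet_Icc).mono fun x hx => ?_
        have ha : a ∈ Icc a b := ⟨le_rfl, hab⟩
        simp only [Pi.add_apply, ← integralL2_apply ha hx hx.1, map_add]
      map_smul' := fun c g => by
        rw [RingHom.id_apply, ← MemLp.toLp_const_smul]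
        refine MemLp.toLp_congr _ _ ?_
        refine (ae_restrict_mem measurableSet_Icc).mono fun x hx => ?_
        have ha : a ∈ Icc a b := ⟨le_rfl, hab⟩
        simp only [Pi.smul_apply, ← integralL2_apply ha hx hx.1, map_smul] }
    (√(b - a) * √(b - a)) fun g => by
      rw [mul_assoc]
      refine Lp.norm_le_of_ae_norm_le hab _ (by positivity) ?_
      filter_upwards [MemLp.coeFn_toLp (Lp.memLp_integral hab g), ae_restrict_mem measurableSet_Icc]
        with x hx hxm
      have ha : a ∈ Icc a b := ⟨le_rfl, hab⟩
      simp only [LinearMap.coe_mk, AddHom.coe_mk]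
      rw [hx]
      refine (norm_integral_le_sqrt_mul_norm ha hxm hxm.1 g).trans ?_
      gcongr
      exact hxm.2

theorem coeFn_volterra (hab : a ≤ b) (g : Lp 𝕜 2 (volume.restrict (Icc a b))) :
    volterra 𝕜 hab g =ᵐ[volume.restrict (Icc a b)] fun x => ∫ t in a..x, g t :=
  MemLp.coeFn_toLp (Lp.memLp_integral hab g)

/-- The approximation of the Volterra operator whose values are step functions, constant on the
intervals of the partition `p`. -/
def volterraStep (𝕜 : Type*) [RCLike 𝕜] (a b : ℝ) (n : ℕ) (p : ℕ → ℝ) :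
    Lp 𝕜 2 (volume.restrict (Icc a b)) →L[𝕜] Lp 𝕜 2 (volume.restrict (Icc a b)) :=
  ∑ k ∈ Finset.range n, (integralL2 𝕜 a b a (p k)).smulRight
    (indicatorConstLp 2 (measurableSet_Ioc (a := p k) (b := p (k + 1))) (measure_ne_top _ _)
      (1 : 𝕜))

theorem isCompactOperator_volterraStep (n : ℕ) (p : ℕ → ℝ) :
    IsCompactOperator (volterraStep 𝕜 a b n p) := by
  have h : volterraStep 𝕜 a b n p ∈ compactOperator (RingHom.id 𝕜)
      (Lp 𝕜 2 (volume.restrict (Icc a b))) (Lp 𝕜 2 (volume.restrict (Icc a b))) := by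
    refine Submodule.sum_mem _ fun k _ => ?_
    exact (isCompactOperator_of_locallyCompactSpace_dom (integralL2 𝕜 a b a (p k))).clm_comp
      ((ContinuousLinearMap.id 𝕜 𝕜).smulRight _)
  exact h

theorem coeFn_volterraStep {n : ℕ} {p : ℕ → ℝ} (hp : Monotone p)
    (g : Lp 𝕜 2 (volume.restrict (Icc a b))) :
    ∀ᵐ x ∂volume.restrict (Icc a b), ∀ k < n, x ∈ Ioc (p k) (p (k + 1)) →
      volterraStep 𝕜 a b n p g x = integralL2 𝕜 a b a (p k) g := by
  have h1 : volterraStep 𝕜 a b n p g =ᵐ[volume.restrict (Icc a b)] fun x =>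
      ∑ k ∈ Finset.range n, (Ioc (p k) (p (k + 1))).indicator
        (fun _ => integralL2 𝕜 a b a (p k) g) x := by
    simp only [volterraStep, sum_apply, ContinuousLinearMap.smulRight_apply]
    refine (Lp.coeFn_finsetSum _ _).trans ?_
    have h2 : ∀ᵐ x ∂volume.restrict (Icc a b), ∀ k ∈ Finset.range n,
        (integralL2 𝕜 a b a (p k) g • indicatorConstLp 2
          (measurableSet_Ioc (a := p k) (b := p (k + 1)))
          (measure_ne_top (volume.restrict (Icc a b)) _) (1 : 𝕜)) x =
        (Ioc (p k) (p (k + 1))).indicator (fun _ => integralL2 𝕜 a b a (p k) g) x := by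
      rw [Filter.eventually_all_finset]
      intro k _
      filter_upwards [Lp.coeFn_smul (integralL2 𝕜 a b a (p k) g) (indicatorConstLp 2
          (measurableSet_Ioc (a := p k) (b := p (k + 1)))
          (measure_ne_top (volume.restrict (Icc a b)) _) (1 : 𝕜)),
        indicatorConstLp_coeFn (p := 2) (hs := measurableSet_Ioc (a := p k) (b := p (k + 1)))
          (hμs := measure_ne_top (volume.restrict (Icc a b)) _) (c := (1 : 𝕜))] with x h3 h4
      rw [h3, Pi.smul_apply, h4]
      by_cases hx : x ∈ Ioc (p k) (p (k + 1)) <;> simp [hx]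
    filter_upwards [h2] with x hx
    rw [Finset.sum_apply]
    exact Finset.sum_congr rfl hx
  filter_upwards [h1] with x hx k hk hxk
  rw [hx, Finset.sum_eq_single k]
  · rw [indicator_of_mem hxk]
  · intro j _ hj
    refine indicator_of_notMem (fun hxj => ?_) _
    rcases lt_or_gt_of_ne hj with h | h
    · exact absurd (hxj.2.trans (hp (show j + 1 ≤ k from h))) (not_le.mpr hxk.1)
    · exact absurd (hxk.2.trans (hp (show k + 1 ≤ j from h))) (not_le.mpr hxj.1)
  · intro h; simp at h; omega

/-- At a point `x` of a partition interval the two operators differ by the integral from its left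
end to `x`, which is at most `√δ ‖g‖` for mesh `δ`. -/
theorem norm_volterra_sub_volterraStep_le (hab : a < b) (n : ℕ) :
    ‖volterra 𝕜 hab.le - volterraStep 𝕜 a b (n + 1) (fun k => a + k * ((b - a) / (n + 1)))‖ ≤
      √(b - a) * √((b - a) / (n + 1)) := by
  set δ := (b - a) / ((n : ℝ) + 1) with hδ
  have hδ0 : 0 < δ := div_pos (by linarith) (by positivity)
  have hδn : ((n : ℝ) + 1) * δ = b - a := by rw [hδ]; field_simp
  have hp : Monotone fun k : ℕ => a + k * δ := by
    intro i j hij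
    have : (i : ℝ) ≤ j := by exact_mod_cast hij
    dsimp only
    gcongr
  refine ContinuousLinearMap.opNorm_le_bound _ (by positivity) fun g => ?_
  rw [mul_assoc]
  refine Lp.norm_le_of_ae_norm_le hab.le _ (by positivity) ?_
  have ha : ∀ᵐ x ∂volume.restrict (Icc a b), x ≠ a :=
    ae_restrict_of_ae (by simp [ae_iff, measure_singleton])
  filter_upwards [Lp.coeFn_sub (volterra 𝕜 hab.le g) (volterraStep 𝕜 a b (n + 1)
      (fun k => a + k * δ) g), coeFn_volterra hab.le g, coeFn_volterraStep (n := n + 1) hp g, ha,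
    ae_restrict_mem measurableSet_Icc] with x h1 h2 h3 hxa hx
  have hxa' : a < x := lt_of_le_of_ne hx.1 hxa.symm
  have ham : a ∈ Icc a b := ⟨le_rfl, hab.le⟩
  -- The partition intervals are open on the left, so the index of the one containing `x` is the
  -- ceiling minus one; the point `a`, which lies in none, was discarded as a null set.
  obtain ⟨k, hk⟩ : ∃ k : ℕ, ⌈(x - a) / δ⌉₊ = k + 1 :=
    Nat.exists_eq_succ_of_ne_zero (Nat.ceil_pos.mpr (div_pos (by linarith) hδ0)).ne'
  have hk1 : (x - a) / δ ≤ k + 1 := by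
    have := Nat.le_ceil ((x - a) / δ); rw [hk] at this; exact_mod_cast this
  have hk2 : k < (x - a) / δ := Nat.lt_ceil.mp (by omega)
  rw [div_le_iff₀ hδ0] at hk1
  rw [lt_div_iff₀ hδ0] at hk2
  have hkn : k < n + 1 := by
    have h4 : (k : ℝ) * δ < ((n : ℝ) + 1) * δ := by rw [hδn]; linarith [hx.2]
    exact_mod_cast lt_of_mul_lt_mul_right h4 hδ0.le
  have hpk : a + k * δ ∈ Icc a b := ⟨by have := mul_nonneg k.cast_nonneg hδ0.le; linarith,
    by linarith [hx.2]⟩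
  have hmem : x ∈ Ioc (a + k * δ) (a + ((k + 1 : ℕ) : ℝ) * δ) :=
    ⟨by linarith, by push_cast; linarith⟩
  have hi {y z : ℝ} (hy : y ∈ Icc a b) (hz : z ∈ Icc a b) :
      IntervalIntegrable (fun t => g t) volume y z :=
    (HasSobolevDeriv.primitive (Lp.memLp g) 0).intervalIntegrable hy hz
  rw [sub_apply, h1, Pi.sub_apply, h2, h3 k hkn hmem,
    integralL2_apply ham hpk hpk.1, intervalIntegral.integral_interval_sub_left (hi ham hx)
    (hi ham hpk)]
  refine (norm_integral_le_sqrt_mul_norm hpk hx (by linarith) g).trans ?_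
  gcongr
  linarith

theorem isCompactOperator_volterra (hab : a < b) : IsCompactOperator (volterra 𝕜 hab.le) := by
  refine isCompactOperator_of_tendsto (l := Filter.atTop) (F := fun n : ℕ =>
    volterraStep 𝕜 a b (n + 1) (fun k => a + k * ((b - a) / (n + 1)))) ?_
    (.of_forall fun n => isCompactOperator_volterraStep _ _)
  rw [tendsto_iff_norm_sub_tendsto_zero]
  refine squeeze_zero (fun _ => norm_nonneg _) (fun n => ?_) (?_ : Filter.Tendsto
    (fun n : ℕ => √(b - a) * √((b - a) / ((n : ℝ) + 1))) _ _)
  · rw [norm_sub_rev]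
    exact norm_volterra_sub_volterraStep_le hab n
  · have h1 : Filter.Tendsto (fun n : ℕ => (b - a) / ((n : ℝ) + 1)) Filter.atTop (nhds 0) :=
      tendsto_const_nhds.div_atTop
        (Filter.tendsto_atTop_add_const_right _ _ tendsto_natCast_atTop_atTop)
    simpa using ((Real.continuous_sqrt.tendsto 0).comp h1).const_mul √(b - a)

end Volterra

/-! ### The form domain in `L₂(Γ)` and the compact operator from derivatives to primitives -/

namespace MetricGraph

variable {𝕜 : Type*} [RCLike 𝕜] {V E : Type*} [Fintype E] (Γ : MetricGraph V E)
  {u u' v v' : E → ℝ → 𝕜}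

/-- The Lebesgue measure on the edge `e`. -/
abbrev edgeMeasure {V E : Type*} (Γ : MetricGraph V E) (e : E) : Measure ℝ :=
  volume.restrict (Icc (Γ.left e) (Γ.right e))

/-- The Hilbert space `L₂(Γ)`, the orthogonal sum of the spaces `L₂` of the edges. -/
abbrev L2 (𝕜 : Type*) [RCLike 𝕜] {V E : Type*} [Fintype E] (Γ : MetricGraph V E) : Type _ :=
  PiLp 2 fun e : E => Lp 𝕜 2 (Γ.edgeMeasure e)

/-- The element of `L₂(Γ)` given by a family of square integrable functions. -/
def toL2 (u : E → ℝ → 𝕜) (hu : ∀ e, MemLp (u e) 2 (Γ.edgeMeasure e)) : Γ.L2 𝕜 :=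
  WithLp.toLp 2 fun e => (hu e).toLp

theorem coeFn_toL2 (hu : ∀ e, MemLp (u e) 2 (Γ.edgeMeasure e)) (e : E) :
    Γ.toL2 u hu e =ᵐ[Γ.edgeMeasure e] u e :=
  (hu e).coeFn_toLp

theorem inner_toL2 (hu : ∀ e, MemLp (u e) 2 (Γ.edgeMeasure e))
    (hv : ∀ e, MemLp (v e) 2 (Γ.edgeMeasure e)) :
    inner 𝕜 (Γ.toL2 u hu) (Γ.toL2 v hv) =
      ∑ e, ∫ x in Icc (Γ.left e) (Γ.right e), starRingEnd 𝕜 (u e x) * v e x := by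
  rw [PiLp.inner_apply]
  refine Finset.sum_congr rfl fun e _ => ?_
  rw [L2.inner_def]
  refine integral_congr_ae ?_
  filter_upwards [Γ.coeFn_toL2 hu e, Γ.coeFn_toL2 hv e] with x h1 h2
  rw [h1, h2, RCLike.inner_apply, mul_comm]

theorem toL2_ext {f g : Γ.L2 𝕜} (h : ∀ e, f e =ᵐ[Γ.edgeMeasure e] g e) : f = g :=
  PiLp.ext fun e => Lp.ext (h e)

/-- `u` is in the form domain of the standard Laplacian, with derivative `u'`: it is in `W₂¹` on
every edge and continuous at every vertex. -/
structure InFormDomain (u u' : E → ℝ → 𝕜) : Prop where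
  deriv : ∀ e, HasSobolevDeriv (Γ.left e) (Γ.right e) (u e) (u' e)
  continuousAtVertices : Γ.ContinuousAtVertices u

variable {Γ}

omit [Fintype E] in
theorem InFormDomain.memLp (h : Γ.InFormDomain u u') (e : E) :
    MemLp (u e) 2 (Γ.edgeMeasure e) :=
  (h.deriv e).memLp (Γ.left_lt_right e).le

omit [Fintype E] in
theorem InFormDomain.memLp_deriv (h : Γ.InFormDomain u u') (e : E) :
    MemLp (u' e) 2 (Γ.edgeMeasure e) :=
  (h.deriv e).1

/-- The element of `L₂(Γ)` given by a function in the form domain. -/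
def InFormDomain.toL2 (h : Γ.InFormDomain u u') : Γ.L2 𝕜 := Γ.toL2 u h.memLp

/-- The element of `L₂(Γ)` given by the derivative of a function in the form domain. -/
def InFormDomain.derivL2 (h : Γ.InFormDomain u u') : Γ.L2 𝕜 := Γ.toL2 u' h.memLp_deriv

variable (Γ)

/-- The function with the values `c (vertex (e, false))` on the edges `e`. -/
def edgeConst (𝕜 : Type*) [RCLike 𝕜] {V E : Type*} [Fintype E] (Γ : MetricGraph V E) :
    (V → 𝕜) →ₗ[𝕜] Γ.L2 𝕜 where
  toFun c := WithLp.toLp 2 fun e => Lp.constₗ 2 (Γ.edgeMeasure e) 𝕜 (c (Γ.vertex (e, false)))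
  map_add' c d := by
    ext1 e
    simp only [PiLp.add_apply, Pi.add_apply, map_add]
  map_smul' r c := by
    ext1 e
    simp only [PiLp.smul_apply, Pi.smul_apply, map_smul, RingHom.id_apply]

theorem coeFn_edgeConst (c : V → 𝕜) (e : E) :
    Γ.edgeConst 𝕜 c e =ᵐ[Γ.edgeMeasure e] fun _ => c (Γ.vertex (e, false)) :=
  Lp.coeFn_const ..

/-- The constant function `1`. -/
def oneL2 (𝕜 : Type*) [RCLike 𝕜] {V E : Type*} [Fintype E] (Γ : MetricGraph V E) : Γ.L2 𝕜 :=
  Γ.edgeConst 𝕜 fun _ => 1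

theorem edgeConst_const (c : 𝕜) : Γ.edgeConst 𝕜 (fun _ => c) = c • Γ.oneL2 𝕜 := by
  rw [oneL2, ← map_smul]
  congr 1
  ext; simp

/-- The integrals of a function over the edges. -/
def edgeIntegral (𝕜 : Type*) [RCLike 𝕜] {V E : Type*} [Fintype E] (Γ : MetricGraph V E) :
    Γ.L2 𝕜 →L[𝕜] (E → 𝕜) :=
  ContinuousLinearMap.pi fun e =>
    integralL2 𝕜 (Γ.left e) (Γ.right e) (Γ.left e) (Γ.right e) ∘L PiLp.proj 2 _ e

theorem edgeIntegral_apply (g : Γ.L2 𝕜) (e : E) :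
    Γ.edgeIntegral 𝕜 g e = ∫ t in Γ.left e..Γ.right e, g e t := by
  have h := (Γ.left_lt_right e).le
  exact integralL2_apply (left_mem_Icc.mpr h) (right_mem_Icc.mpr h) h (g e)

/-- The differences of the values of a function on the vertices along the edges. -/
def coboundary (𝕜 : Type*) [RCLike 𝕜] {V E : Type*} (Γ : MetricGraph V E) :
    (V → 𝕜) →ₗ[𝕜] (E → 𝕜) where
  toFun c e := c (Γ.vertex (e, true)) - c (Γ.vertex (e, false))
  map_add' c d := by ext e; simp only [Pi.add_apply]; ring
  map_smul' r c := by ext e; simp only [Pi.smul_apply, smul_eq_mul, RingHom.id_apply]; ring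

omit [Fintype E] in
theorem coboundary_apply (c : V → 𝕜) (e : E) :
    Γ.coboundary 𝕜 c e = c (Γ.vertex (e, true)) - c (Γ.vertex (e, false)) :=
  rfl

-- Connectedness enters here: `c - d` does not change along an edge, so it is the same at all
-- vertices.
omit [Fintype E] in
theorem Connected.eq_of_coboundary_eq {Γ : MetricGraph V E} (hΓ : Γ.Connected) {c d : V → 𝕜}
    (h : Γ.coboundary 𝕜 c = Γ.coboundary 𝕜 d) : ∃ r : 𝕜, ∀ v, c v = d v + r := by
  obtain ⟨⟨v₀⟩, hconn⟩ := hΓ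
  refine ⟨c v₀ - d v₀, fun v => ?_⟩
  have key : ∀ x y, Relation.EqvGen
      (fun x y => ∃ e, Γ.vertex (e, false) = x ∧ Γ.vertex (e, true) = y) x y →
      c x - d x = c y - d y := by
    intro x y hxy
    induction hxy with
    | rel x y hxy =>
      obtain ⟨e, rfl, rfl⟩ := hxy
      have := congrFun h e
      simp only [coboundary_apply] at this
      linear_combination -this
    | refl => rfl
    | symm _ _ _ ih => exact ih.symm
    | trans _ _ _ _ _ ih1 ih2 => exact ih1.trans ih2
  linear_combination key v v₀ (hconn v v₀)

/-- The derivatives of the functions in the form domain. -/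
def derivSpace (𝕜 : Type*) [RCLike 𝕜] {V E : Type*} [Fintype E] (Γ : MetricGraph V E) :
    Submodule 𝕜 (Γ.L2 𝕜) :=
  (LinearMap.range (Γ.coboundary 𝕜)).comap (Γ.edgeIntegral 𝕜).toLinearMap

/-- The range of the coboundary lies in the finite-dimensional space `E → 𝕜`, so it is closed.
Closedness makes the space of derivatives a Hilbert space, as the norm-attainment argument requires.
-/
theorem isClosed_derivSpace : IsClosed (Γ.derivSpace 𝕜 : Set (Γ.L2 𝕜)) :=
  (Submodule.closed_of_finiteDimensional (LinearMap.range (Γ.coboundary 𝕜))).preimage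
    (Γ.edgeIntegral 𝕜).continuous

instance : CompleteSpace (Γ.derivSpace 𝕜) :=
  Γ.isClosed_derivSpace.completeSpace_coe

/-- The operator that applies the Volterra operator on every edge. -/
def edgeVolterra (𝕜 : Type*) [RCLike 𝕜] {V E : Type*} [Fintype E] (Γ : MetricGraph V E) :
    Γ.L2 𝕜 →L[𝕜] Γ.L2 𝕜 :=
  open Classical in
  ∑ e, (((PiLp.continuousLinearEquiv 2 𝕜 fun e : E => Lp 𝕜 2 (Γ.edgeMeasure e)).symm :
      (∀ e : E, Lp 𝕜 2 (Γ.edgeMeasure e)) →L[𝕜] Γ.L2 𝕜) ∘L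
    ContinuousLinearMap.single 𝕜 (fun e : E => Lp 𝕜 2 (Γ.edgeMeasure e)) e) ∘L
    (volterra 𝕜 (Γ.left_lt_right e).le ∘L PiLp.proj 2 _ e)

theorem edgeVolterra_apply (g : Γ.L2 𝕜) (e : E) :
    Γ.edgeVolterra 𝕜 g e = volterra 𝕜 (Γ.left_lt_right e).le (g e) := by
  classical
  simp only [edgeVolterra, sum_apply, ContinuousLinearMap.comp_apply, WithLp.ofLp_sum,
    Finset.sum_apply]
  rw [Finset.sum_eq_single e]
  · simp
  · intro e' _ he
    simp [Pi.single_eq_of_ne he.symm]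
  · simp

theorem isCompactOperator_edgeVolterra : IsCompactOperator (Γ.edgeVolterra 𝕜) := by
  classical
  have h : Γ.edgeVolterra 𝕜 ∈ compactOperator (RingHom.id 𝕜) (Γ.L2 𝕜) (Γ.L2 𝕜) := by
    refine Submodule.sum_mem _ fun e _ => ?_
    have hc : IsCompactOperator (volterra 𝕜 (Γ.left_lt_right e).le ∘L
        PiLp.proj 2 (𝕜 := 𝕜) (fun e : E => Lp 𝕜 2 (Γ.edgeMeasure e)) e) :=
      (isCompactOperator_volterra (Γ.left_lt_right e)).comp_clm _
    exact hc.clm_comp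
      (((PiLp.continuousLinearEquiv 2 𝕜 fun e : E => Lp 𝕜 2 (Γ.edgeMeasure e)).symm :
        (∀ e : E, Lp 𝕜 2 (Γ.edgeMeasure e)) →L[𝕜] Γ.L2 𝕜) ∘L
        ContinuousLinearMap.single 𝕜 (fun e : E => Lp 𝕜 2 (Γ.edgeMeasure e)) e)
  exact h

/-- A linear section on a finite-dimensional space is automatically continuous, so `primitiveL2` is
bounded whichever section is chosen. -/
theorem exists_rightInverse_coboundary :
    ∃ s : LinearMap.range (Γ.coboundary 𝕜) →ₗ[𝕜] (V → 𝕜),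
      (Γ.coboundary 𝕜).rangeRestrict ∘ₗ s = LinearMap.id :=
  (Γ.coboundary 𝕜).rangeRestrict.exists_rightInverse_of_surjective (LinearMap.range_rangeRestrict _)

/-- A linear choice of values at the vertices with given differences along the edges. -/
def vertexPotential (𝕜 : Type*) [RCLike 𝕜] {V E : Type*} [Fintype E] (Γ : MetricGraph V E) :
    LinearMap.range (Γ.coboundary 𝕜) →ₗ[𝕜] (V → 𝕜) :=
  (Γ.exists_rightInverse_coboundary (𝕜 := 𝕜)).choose

theorem coboundary_vertexPotential (y : LinearMap.range (Γ.coboundary 𝕜)) :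
    Γ.coboundary 𝕜 (Γ.vertexPotential 𝕜 y) = y :=
  congrArg Subtype.val (LinearMap.congr_fun Γ.exists_rightInverse_coboundary.choose_spec y)

/-- The edge integrals of a derivative, as an element of the range of the coboundary. -/
def derivIntegral (𝕜 : Type*) [RCLike 𝕜] {V E : Type*} [Fintype E] (Γ : MetricGraph V E) :
    Γ.derivSpace 𝕜 →L[𝕜] LinearMap.range (Γ.coboundary 𝕜) :=
  (Γ.edgeIntegral 𝕜 ∘L (Γ.derivSpace 𝕜).subtypeL).codRestrict _ fun g => g.2

/-- The operator that recovers a function in the form domain, up to a constant, from its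
derivative. -/
def primitiveL2 (𝕜 : Type*) [RCLike 𝕜] {V E : Type*} [Fintype E] (Γ : MetricGraph V E) :
    Γ.derivSpace 𝕜 →L[𝕜] Γ.L2 𝕜 :=
  Γ.edgeVolterra 𝕜 ∘L (Γ.derivSpace 𝕜).subtypeL +
    (Γ.edgeConst 𝕜 ∘ₗ Γ.vertexPotential 𝕜).toContinuousLinearMap ∘L Γ.derivIntegral 𝕜

/-- The Volterra part is compact, and the correction by vertex values factors through a
finite-dimensional space. -/
theorem isCompactOperator_primitiveL2 : IsCompactOperator (Γ.primitiveL2 𝕜) :=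
  (Γ.isCompactOperator_edgeVolterra.comp_clm _).add
    ((isCompactOperator_of_locallyCompactSpace_dom (Γ.derivIntegral 𝕜)).clm_comp
      (Γ.edgeConst 𝕜 ∘ₗ Γ.vertexPotential 𝕜).toContinuousLinearMap)

/-- The operator that recovers a function of mean zero in the form domain from its derivative. -/
def meanZeroPrimitive (𝕜 : Type*) [RCLike 𝕜] {V E : Type*} [Fintype E] (Γ : MetricGraph V E) :
    Γ.derivSpace 𝕜 →L[𝕜] Γ.L2 𝕜 :=
  (Submodule.span 𝕜 {Γ.oneL2 𝕜})ᗮ.starProjection ∘L Γ.primitiveL2 𝕜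

theorem isCompactOperator_meanZeroPrimitive : IsCompactOperator (Γ.meanZeroPrimitive 𝕜) :=
  Γ.isCompactOperator_primitiveL2.clm_comp (Submodule.span 𝕜 {Γ.oneL2 𝕜})ᗮ.starProjection

theorem coeFn_primitiveL2 (g : Γ.derivSpace 𝕜) (e : E) :
    Γ.primitiveL2 𝕜 g e =ᵐ[Γ.edgeMeasure e] fun x =>
      Γ.vertexPotential 𝕜 (Γ.derivIntegral 𝕜 g) (Γ.vertex (e, false)) +
        ∫ t in Γ.left e..x, (g : Γ.L2 𝕜) e t := by
  have h : Γ.primitiveL2 𝕜 g e = volterra 𝕜 (Γ.left_lt_right e).le ((g : Γ.L2 𝕜) e) +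
      Γ.edgeConst 𝕜 (Γ.vertexPotential 𝕜 (Γ.derivIntegral 𝕜 g)) e := by
    rw [← edgeVolterra_apply]
    rfl
  rw [h]
  filter_upwards [Lp.coeFn_add (volterra 𝕜 (Γ.left_lt_right e).le ((g : Γ.L2 𝕜) e))
    (Γ.edgeConst 𝕜 (Γ.vertexPotential 𝕜 (Γ.derivIntegral 𝕜 g)) e),
    coeFn_volterra (Γ.left_lt_right e).le ((g : Γ.L2 𝕜) e),
    Γ.coeFn_edgeConst (Γ.vertexPotential 𝕜 (Γ.derivIntegral 𝕜 g)) e] with x h1 h2 h3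
  rw [h1, Pi.add_apply, h2, h3, add_comm]

variable {Γ}

theorem InFormDomain.edgeIntegral_derivL2 (h : Γ.InFormDomain u u') :
    Γ.edgeIntegral 𝕜 h.derivL2 = Γ.coboundary 𝕜 (Γ.vertexValue u) := by
  ext e
  have hab := (Γ.left_lt_right e).le
  have h1 := (h.deriv e).2 _ (right_mem_Icc.mpr hab)
  simp only [coboundary_apply,
    Γ.vertexValue_vertex u h.continuousAtVertices]
  rw [edgeIntegral_apply]
  simp only [endValue, coord]
  simp only [if_true, h1, Bool.false_eq_true, if_false, add_sub_cancel_left]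
  refine intervalIntegral.integral_congr_ae ?_
  rw [uIoc_of_le hab, ← ae_restrict_iff' measurableSet_Ioc]
  exact ae_restrict_of_ae_restrict_of_subset Ioc_subset_Icc_self (Γ.coeFn_toL2 h.memLp_deriv e)

theorem InFormDomain.derivL2_mem (h : Γ.InFormDomain u u') : h.derivL2 ∈ Γ.derivSpace 𝕜 :=
  ⟨Γ.vertexValue u, h.edgeIntegral_derivL2.symm⟩

/-- The vertex values of `u` and the chosen potential have the same differences along the edges, so
they differ by a constant on a connected graph. -/
theorem InFormDomain.exists_toL2_eq (h : Γ.InFormDomain u u') (hΓ : Γ.Connected) :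
    ∃ r : 𝕜, h.toL2 = Γ.primitiveL2 𝕜 ⟨h.derivL2, h.derivL2_mem⟩ + r • Γ.oneL2 𝕜 := by
  set g : Γ.derivSpace 𝕜 := ⟨h.derivL2, h.derivL2_mem⟩ with hg
  obtain ⟨r, hr⟩ := hΓ.eq_of_coboundary_eq (c := Γ.vertexValue u)
    (d := Γ.vertexPotential 𝕜 (Γ.derivIntegral 𝕜 g))
    (by rw [coboundary_vertexPotential, ← h.edgeIntegral_derivL2]; rfl)
  refine ⟨r, Γ.toL2_ext fun e => ?_⟩
  rw [← edgeConst_const, PiLp.add_apply]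
  filter_upwards [Γ.coeFn_toL2 h.memLp e, Γ.coeFn_toL2 h.memLp_deriv e,
    Lp.coeFn_add (Γ.primitiveL2 𝕜 g e) (Γ.edgeConst 𝕜 (fun _ => r) e), Γ.coeFn_primitiveL2 g e,
    Γ.coeFn_edgeConst (fun _ => r) e, ae_restrict_mem measurableSet_Icc]
    with x h1 h2 h3 h4 h5 hx
  have h6 := hr (Γ.vertex (e, false))
  rw [Γ.vertexValue_vertex u h.continuousAtVertices] at h6
  have h7 : ∫ t in Γ.left e..x, u' e t = ∫ t in Γ.left e..x, (g : Γ.L2 𝕜) e t := by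
    refine intervalIntegral.integral_congr_ae ?_
    rw [uIoc_of_le hx.1, ← ae_restrict_iff' measurableSet_Ioc]
    refine ae_restrict_of_ae_restrict_of_subset
      (Ioc_subset_Icc_self.trans (Icc_subset_Icc_right hx.2)) ?_
    exact (Γ.coeFn_toL2 h.memLp_deriv e).symm
  rw [h3, Pi.add_apply, h4, h5, InFormDomain.toL2, h1, (h.deriv e).2 x hx, h7]
  simp only [endValue, coord, Bool.false_eq_true, if_false] at h6
  rw [h6]
  ring

/-- Projecting off the constants removes the ambiguity left by the choice of potential. -/
theorem InFormDomain.meanZeroPrimitive_derivL2 (h : Γ.InFormDomain u u') (hΓ : Γ.Connected) :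
    Γ.meanZeroPrimitive 𝕜 ⟨h.derivL2, h.derivL2_mem⟩ =
      (Submodule.span 𝕜 {Γ.oneL2 𝕜})ᗮ.starProjection h.toL2 := by
  obtain ⟨r, hr⟩ := h.exists_toL2_eq hΓ
  have h0 : (Submodule.span 𝕜 {Γ.oneL2 𝕜})ᗮ.starProjection (Γ.oneL2 𝕜) = 0 := by
    rw [Submodule.starProjection_apply_eq_zero_iff]
    exact Submodule.le_orthogonal_orthogonal _ (Submodule.mem_span_singleton_self _)
  rw [hr, map_add, map_smul, h0, smul_zero, add_zero]
  rfl

theorem InFormDomain.meanZeroPrimitive_derivL2_of_inner_eq_zero (h : Γ.InFormDomain u u')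
    (hΓ : Γ.Connected) (h0 : inner 𝕜 (Γ.oneL2 𝕜) h.toL2 = 0) :
    Γ.meanZeroPrimitive 𝕜 ⟨h.derivL2, h.derivL2_mem⟩ = h.toL2 := by
  rw [h.meanZeroPrimitive_derivL2 hΓ, Submodule.starProjection_eq_self_iff,
    Submodule.mem_orthogonal_singleton_iff_inner_right, h0]

omit [Fintype E] in
theorem InFormDomain.sub_const (h : Γ.InFormDomain u u') (c : 𝕜) :
    Γ.InFormDomain (fun e x => u e x - c) u' :=
  ⟨fun e => (h.deriv e).sub_const c, fun p q hpq => by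
    have := h.continuousAtVertices p q hpq
    simp only [endValue] at this ⊢
    rw [this]⟩

theorem InFormDomain.toL2_sub_const (h : Γ.InFormDomain u u') (c : 𝕜) :
    (h.sub_const c).toL2 = h.toL2 - c • Γ.oneL2 𝕜 := by
  refine Γ.toL2_ext fun e => ?_
  rw [← edgeConst_const, PiLp.sub_apply]
  filter_upwards [Γ.coeFn_toL2 h.memLp e, Γ.coeFn_toL2 (h.sub_const c).memLp e,
    Lp.coeFn_sub (h.toL2 e) (Γ.edgeConst 𝕜 (fun _ => c) e), Γ.coeFn_edgeConst (fun _ => c) e]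
    with x h1 h2 h3 h4
  rw [h3, Pi.sub_apply, h4, InFormDomain.toL2, InFormDomain.toL2, h1, h2]

/-- Every element of the space of derivatives is the derivative of a function of mean zero. -/
theorem exists_inFormDomain_of_mem_derivSpace (hΓ : Γ.Connected) (g : Γ.derivSpace 𝕜) :
    ∃ (u u' : E → ℝ → 𝕜) (h : Γ.InFormDomain u u'), h.derivL2 = g ∧
      h.toL2 = Γ.meanZeroPrimitive 𝕜 g ∧ inner 𝕜 (Γ.oneL2 𝕜) h.toL2 = 0 := by
  set c := Γ.vertexPotential 𝕜 (Γ.derivIntegral 𝕜 g) with hc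
  set u : E → ℝ → 𝕜 := fun e x =>
    c (Γ.vertex (e, false)) + ∫ t in Γ.left e..x, (g : Γ.L2 𝕜) e t with hu
  -- Continuity at the vertices: at a right endpoint the edge integral of `g` is exactly the
  -- difference of `c` along the edge, because `g` lies in `derivSpace`.
  have hend : ∀ p, Γ.endValue u p = c (Γ.vertex p) := by
    rintro ⟨e, _ | _⟩
    · simp [endValue, coord, hu]
    · have h1 := congrFun (Γ.coboundary_vertexPotential (Γ.derivIntegral 𝕜 g)) e
      have h2 : (Γ.derivIntegral 𝕜 g : E → 𝕜) e = ∫ t in Γ.left e..Γ.right e, (g : Γ.L2 𝕜) e t :=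
        Γ.edgeIntegral_apply _ _
      rw [h2] at h1
      rw [coboundary_apply] at h1
      simp only [endValue, coord, hu, if_true, ← h1, hc]
      rw [add_sub_cancel]
  have h : Γ.InFormDomain u fun e => (g : Γ.L2 𝕜) e :=
    ⟨fun e => HasSobolevDeriv.primitive (Lp.memLp _) _, fun p q hpq => by rw [hend, hend, hpq]⟩
  have hd : h.derivL2 = g := Γ.toL2_ext fun e => Γ.coeFn_toL2 h.memLp_deriv e
  have hT := h.meanZeroPrimitive_derivL2 hΓ
  have hd' : (⟨h.derivL2, h.derivL2_mem⟩ : Γ.derivSpace 𝕜) = g := Subtype.ext hd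
  rw [hd', Submodule.starProjection_orthogonal_val] at hT
  obtain ⟨r, hr⟩ := Submodule.mem_span_singleton.mp
    ((Submodule.span 𝕜 {Γ.oneL2 𝕜}).starProjection_apply_mem h.toL2)
  have h2 : (h.sub_const r).toL2 = Γ.meanZeroPrimitive 𝕜 g := by
    rw [h.toL2_sub_const, hr, hT]
  refine ⟨_, _, h.sub_const r, hd, h2, ?_⟩
  rw [h2, ← Submodule.mem_orthogonal_singleton_iff_inner_right]
  exact Submodule.starProjection_apply_mem _ _

end MetricGraph

/-! ### Regularity of weak solutions on an interval -/

section Interval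

variable {𝕜 : Type*} [RCLike 𝕜] {a b : ℝ} {f f' : ℝ → 𝕜}

theorem ae_eq_zero_of_integral_conj_mul_self_eq_zero {μ : Measure ℝ} {h : ℝ → 𝕜}
    (hh : MemLp h 2 μ) (h0 : ∫ x, starRingEnd 𝕜 (h x) * h x ∂μ = 0) : h =ᵐ[μ] 0 := by
  have h1 : ∀ x, starRingEnd 𝕜 (h x) * h x = ((‖h x‖ ^ 2 : ℝ) : 𝕜) := fun x => by
    rw [RCLike.conj_mul]; norm_cast
  simp_rw [h1] at h0
  rw [integral_ofReal, RCLike.ofReal_eq_zero, integral_eq_zero_iff_of_nonneg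
    (fun x => by positivity) ((memLp_two_iff_integrable_sq_norm hh.1).mp hh)] at h0
  filter_upwards [h0] with x hx
  simpa using hx

/-- The lemma of du Bois-Reymond: a weak solution of `-f'' = l f` is in `W₂²`. -/
theorem HasSobolevDeriv.exists_deriv_two_of_weak (hab : a < b) (hf : HasSobolevDeriv a b f f')
    (l : 𝕜)
    (hw : ∀ v v' : ℝ → 𝕜, HasSobolevDeriv a b v v' → v a = 0 → v b = 0 →
      ∫ x in Icc a b, starRingEnd 𝕜 (v' x) * f' x =
        l * ∫ x in Icc a b, starRingEnd 𝕜 (v x) * f x) :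
    ∃ w, f' =ᵐ[volume.restrict (Icc a b)] w ∧ HasSobolevDeriv a b w fun x => -(l * f x) := by
  have hfl := hf.memLp hab.le
  have hF : HasSobolevDeriv a b (fun x => 0 + ∫ t in a..x, l * f t) fun x => l * f x :=
    HasSobolevDeriv.primitive (hfl.const_mul l) 0
  set F : ℝ → 𝕜 := fun x => 0 + ∫ t in a..x, l * f t
  have hgm : MemLp (fun x => f' x + F x) 2 (volume.restrict (Icc a b)) :=
    hf.1.add (hF.memLp hab.le)
  have hgi : Integrable (fun x => f' x + F x) (volume.restrict (Icc a b)) :=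
    hgm.integrable one_le_two
  -- `k` is the mean of `f' + F`, so `h = f' + F - k` has integral zero and its primitive vanishes
  -- at both ends. Testing with this primitive yields `∫ |h|² = 0`.
  set k : 𝕜 := (∫ x in Icc a b, (f' x + F x)) / ((b - a : ℝ) : 𝕜) with hk
  have hba : ((b - a : ℝ) : 𝕜) ≠ 0 := by
    rw [Ne, RCLike.ofReal_eq_zero]; linarith
  set h : ℝ → 𝕜 := fun x => f' x + F x - k with hh
  have hhm : MemLp h 2 (volume.restrict (Icc a b)) := hgm.sub (memLp_const k)
  have hh0 : ∫ x in Icc a b, h x = 0 := by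
    rw [hh, integral_sub hgi (integrable_const k), integral_const, measureReal_def,
      Measure.restrict_apply_univ, Real.volume_Icc, ENNReal.toReal_ofReal (by linarith),
      RCLike.real_smul_eq_coe_mul, hk]
    field_simp
    ring
  have hv := HasSobolevDeriv.primitive hhm 0
  have hvb : (0 : 𝕜) + ∫ t in a..b, h t = 0 := by
    rw [intervalIntegral.integral_of_le hab.le, ← integral_Icc_eq_integral_Ioc, hh0, zero_add]
  have h1 := hw _ _ hv (by simp) hvb
  have h2 := hv.conj.integral_deriv_mul_add hab.le hF
  rw [hvb] at h2
  simp only [intervalIntegral.integral_same, add_zero, map_zero, zero_mul, sub_zero] at h2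
  have h3 : ∫ x in Icc a b, starRingEnd 𝕜 (h x) * h x = 0 := by
    have i1 : Integrable (fun x => starRingEnd 𝕜 (h x) * f' x) (volume.restrict (Icc a b)) :=
      hhm.star.integrable_mul hf.1
    have i2 : Integrable (fun x => starRingEnd 𝕜 (h x) * F x) (volume.restrict (Icc a b)) :=
      hhm.star.integrable_mul (hF.memLp hab.le)
    have i3 : Integrable (fun x => starRingEnd 𝕜 (h x) * k) (volume.restrict (Icc a b)) :=
      (hhm.star.integrable one_le_two).mul_const k
    have e1 : ∀ x, starRingEnd 𝕜 (h x) * h x = starRingEnd 𝕜 (h x) * f' x +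
        starRingEnd 𝕜 (h x) * F x - starRingEnd 𝕜 (h x) * k := fun x => by
      simp only [hh]; ring
    simp_rw [e1]
    rw [integral_sub (show Integrable (fun x => starRingEnd 𝕜 (h x) * f' x +
      starRingEnd 𝕜 (h x) * F x) (volume.restrict (Icc a b)) from i1.add i2) i3,
      integral_add i1 i2, h1, integral_mul_const, integral_conj,
      hh0, map_zero, zero_mul, sub_zero, ← integral_const_mul, add_comm]
    refine Eq.trans ?_ h2
    congr 2
    ext x
    ring
  refine ⟨fun x => k - F x, ?_, ?_⟩
  · filter_upwards [ae_eq_zero_of_integral_conj_mul_self_eq_zero hhm h3] with x hx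
    simp only [hh, Pi.zero_apply] at hx
    linear_combination hx
  · have := (HasSobolevDeriv.const (a := a) (b := b) k).add (hF.const_mul (-1))
    convert! this using 2 <;> ring

end Interval

/-! ### The Rayleigh minimum and the weak form of the eigenvalue equation -/

namespace MetricGraph

variable {𝕜 : Type*} [RCLike 𝕜] {V E : Type*} [Fintype E] {Γ : MetricGraph V E}
  {u u' u'' v v' : E → ℝ → 𝕜}

/-- Functions in the form domain are continuous on edges of positive length, so vanishing almost
everywhere means vanishing everywhere. -/
theorem InFormDomain.restrict_eq_zero_iff (h : Γ.InFormDomain u u') :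
    Γ.restrict u = 0 ↔ h.toL2 = 0 := by
  constructor
  · intro h0
    refine Γ.toL2_ext fun e => (Γ.coeFn_toL2 h.memLp e).trans ?_
    filter_upwards [Lp.coeFn_zero 𝕜 2 (Γ.edgeMeasure e), ae_restrict_mem measurableSet_Icc]
      with x h1 hx
    rw [PiLp.zero_apply, h1]
    exact congrFun h0 ⟨e, x, hx⟩
  · intro h0
    ext ⟨e, x, hx⟩
    have h1 : u e =ᵐ[Γ.edgeMeasure e] fun _ => 0 := by
      filter_upwards [Γ.coeFn_toL2 h.memLp e, Lp.coeFn_zero 𝕜 2 (Γ.edgeMeasure e)] with y h2 h3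
      rw [← h2, show Γ.toL2 u h.memLp = 0 from h0, PiLp.zero_apply, h3, Pi.zero_apply]
    exact Measure.eqOn_Icc_of_ae_eq volume (Γ.left_lt_right e).ne h1
      ((h.deriv e).continuousOn (Γ.left_lt_right e).le) continuousOn_const hx

theorem InFormDomain.restrict_eq_const_iff (h : Γ.InFormDomain u u') (c : 𝕜) :
    Γ.restrict u = (fun _ => c) ↔ h.toL2 = c • Γ.oneL2 𝕜 := by
  rw [← sub_eq_zero (a := h.toL2), ← h.toL2_sub_const, ← restrict_eq_zero_iff]
  simp only [funext_iff, restrict, Pi.zero_apply, sub_eq_zero]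

omit [Fintype E] in
theorem Connected.nonempty_edge (hΓ : Γ.Connected) : Nonempty E := by
  obtain ⟨⟨v⟩, -⟩ := hΓ
  obtain ⟨p, -⟩ := Γ.vertex_surjective v
  exact ⟨p.1⟩

omit [Fintype E] in
/-- The extension by zero of a function on an edge that vanishes at the endpoints. -/
theorem inFormDomain_of_edge [DecidableEq E] (e₀ : E) {f f' : ℝ → 𝕜}
    (hf : HasSobolevDeriv (Γ.left e₀) (Γ.right e₀) f f') (ha : f (Γ.left e₀) = 0)
    (hb : f (Γ.right e₀) = 0) :
    Γ.InFormDomain (fun e => if e = e₀ then f else 0) (fun e => if e = e₀ then f' else 0) := by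
  refine ⟨fun e => ?_, ?_⟩
  · by_cases he : e = e₀
    · subst he; simpa using hf
    · simp only [he, if_false]
      exact HasSobolevDeriv.const 0
  · have : ∀ p, Γ.endValue (fun e => if e = e₀ then f else 0) p = 0 := by
      rintro ⟨e, i⟩
      by_cases he : e = e₀
      · subst he
        cases i <;> simp [endValue, coord, ha, hb]
      · simp [endValue, he]
    intro p q _
    rw [this, this]

/-- The bump `(x - a)(b - x)` on one edge, extended by zero, is in the form domain and not constant.
-/
theorem meanZeroPrimitive_ne_zero (hΓ : Γ.Connected) : Γ.meanZeroPrimitive 𝕜 ≠ 0 := by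
  classical
  intro h0
  obtain ⟨e₀⟩ := hΓ.nonempty_edge
  set a := Γ.left e₀ with ha
  set b := Γ.right e₀ with hb
  have hab : a < b := Γ.left_lt_right e₀
  have hsq : HasSobolevDeriv (𝕜 := 𝕜) a b (fun x => (((x - a) * (b - x) : ℝ) : 𝕜))
      fun x => ((a + b - 2 * x : ℝ) : 𝕜) := by
    refine ⟨?_, fun x hx => ?_⟩
    · refine MemLp.ofReal ?_
      refine MemLp.of_bound (C := b - a) (by fun_prop) ?_
      refine (ae_restrict_mem measurableSet_Icc).mono fun x hx => ?_
      rw [Real.norm_eq_abs, abs_le]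
      constructor <;> linarith [hx.1, hx.2]
    · beta_reduce
      rw [intervalIntegral.integral_of_le hx.1, integral_ofReal,
        ← intervalIntegral.integral_of_le hx.1, ← RCLike.ofReal_add]
      congr 1
      have : ∀ y ∈ uIcc a x, HasDerivAt (fun y => (y - a) * (b - y)) (a + b - 2 * y) y := by
        intro y _
        have := ((hasDerivAt_id y).sub_const a).mul ((hasDerivAt_id y).const_sub b)
        convert! this using 1
        simp; ring
      rw [intervalIntegral.integral_eq_sub_of_hasDerivAt this
        (Continuous.intervalIntegrable (by fun_prop) _ _)]
      ring
  have hfd := inFormDomain_of_edge (Γ := Γ) e₀ hsq (by simp [a]) (by simp [b])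
  have h1 := hfd.meanZeroPrimitive_derivL2 hΓ
  rw [h0, zero_apply, eq_comm, Submodule.starProjection_apply_eq_zero_iff,
    Submodule.orthogonal_orthogonal, Submodule.mem_span_singleton] at h1
  obtain ⟨c, hc⟩ := h1
  have h2 := (hfd.restrict_eq_const_iff c).mpr hc.symm
  have h3 := congrFun h2 ⟨e₀, a, le_rfl, hab.le⟩
  have h4 := congrFun h2 ⟨e₀, (a + b) / 2, by linarith, by linarith⟩
  simp only [restrict, if_true] at h3 h4
  rw [← h3, RCLike.ofReal_inj] at h4
  nlinarith

/-- Existence of a minimizer of the Rayleigh quotient among the functions of mean zero. -/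
theorem exists_rayleigh_minimum (𝕜 : Type*) [RCLike 𝕜] (hΓ : Γ.Connected) :
    ∃ l : ℝ, 0 < l ∧
      (∀ (u u' : E → ℝ → 𝕜) (h : Γ.InFormDomain u u'), inner 𝕜 (Γ.oneL2 𝕜) h.toL2 = 0 →
        l * ‖h.toL2‖ ^ 2 ≤ ‖h.derivL2‖ ^ 2) ∧
      (∀ (u u' : E → ℝ → 𝕜) (h : Γ.InFormDomain u u'), inner 𝕜 (Γ.oneL2 𝕜) h.toL2 = 0 →
        ‖h.derivL2‖ ^ 2 = l * ‖h.toL2‖ ^ 2 →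
        ∀ (v v' : E → ℝ → 𝕜) (hv : Γ.InFormDomain v v'),
          inner 𝕜 hv.derivL2 h.derivL2 = (l : 𝕜) * inner 𝕜 hv.toL2 h.toL2) ∧
      ∃ (u u' : E → ℝ → 𝕜) (h : Γ.InFormDomain u u'), inner 𝕜 (Γ.oneL2 𝕜) h.toL2 = 0 ∧
        h.toL2 ≠ 0 ∧ ‖h.derivL2‖ ^ 2 = l * ‖h.toL2‖ ^ 2 := by
  set T := Γ.meanZeroPrimitive 𝕜 with hT
  have hT0 : 0 < ‖T‖ := (norm_pos_iff (a := T)).mpr (meanZeroPrimitive_ne_zero hΓ)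
  refine ⟨(‖T‖ ^ 2)⁻¹, by positivity, fun u u' h h0 => ?_, fun u u' h h0 heq v v' hv => ?_, ?_⟩
  · have h1 := T.le_opNorm ⟨h.derivL2, h.derivL2_mem⟩
    rw [hT, h.meanZeroPrimitive_derivL2_of_inner_eq_zero hΓ h0, ← hT] at h1
    rw [inv_mul_le_iff₀ (by positivity), ← mul_pow]
    gcongr
    exact h1
  · have h1 := h.meanZeroPrimitive_derivL2_of_inner_eq_zero hΓ h0
    have h2 := hv.meanZeroPrimitive_derivL2 hΓ
    have h3 : ‖T ⟨h.derivL2, h.derivL2_mem⟩‖ = ‖T‖ * ‖(⟨h.derivL2, h.derivL2_mem⟩ :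
        Γ.derivSpace 𝕜)‖ := by
      rw [hT, h1, ← hT, Submodule.coe_norm]
      refine (pow_left_inj₀ (norm_nonneg _) (by positivity) two_ne_zero).mp ?_
      rw [mul_pow, heq]
      field_simp
    have h4 := ContinuousLinearMap.inner_apply_apply_of_norm_apply_eq h3
      ⟨hv.derivL2, hv.derivL2_mem⟩
    -- The test function `v` need not have mean zero: the projection moves from `v` to `u`, which it
    -- fixes.
    rw [hT, h1, h2, ← hT, ← Submodule.inner_starProjection_left_eq_right,
      (Submodule.starProjection_eq_self_iff).mpr
        (Submodule.mem_orthogonal_singleton_iff_inner_right.mpr h0), Submodule.coe_inner] at h4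
    have h5 := congrArg (starRingEnd 𝕜) h4
    rw [map_mul, inner_conj_symm, inner_conj_symm, RCLike.conj_ofReal] at h5
    rw [h5, RCLike.ofReal_inv, inv_mul_cancel_left₀]
    rw [Ne, RCLike.ofReal_eq_zero]
    positivity
  · obtain ⟨x, hx1, hx2⟩ :=
      (Γ.isCompactOperator_meanZeroPrimitive (𝕜 := 𝕜)).exists_norm_eq_one_norm_apply_eq
        (meanZeroPrimitive_ne_zero hΓ)
    obtain ⟨u, u', h, h1, h2, h3⟩ := exists_inFormDomain_of_mem_derivSpace hΓ x
    have h4 : ‖h.toL2‖ = ‖T‖ := by rw [h2, hx2]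
    refine ⟨u, u', h, h3, ?_, ?_⟩
    · rw [← norm_pos_iff, h4]; exact hT0
    · rw [h1, ← Submodule.coe_norm, hx1, h4]
      field_simp

theorem InFormDomain.inner_derivL2 (hv : Γ.InFormDomain v v') (h : Γ.InFormDomain u u') :
    inner 𝕜 hv.derivL2 h.derivL2 =
      ∑ e, ∫ x in Icc (Γ.left e) (Γ.right e), starRingEnd 𝕜 (v' e x) * u' e x :=
  Γ.inner_toL2 _ _

theorem InFormDomain.inner_toL2 (hv : Γ.InFormDomain v v') (h : Γ.InFormDomain u u') :
    inner 𝕜 hv.toL2 h.toL2 =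
      ∑ e, ∫ x in Icc (Γ.left e) (Γ.right e), starRingEnd 𝕜 (v e x) * u e x :=
  Γ.inner_toL2 _ _

/-- Green's formula. -/
theorem InFormDomain.sum_integral_add (hv : Γ.InFormDomain v v')
    (hu : ∀ e, HasSobolevDeriv (Γ.left e) (Γ.right e) (u' e) (u'' e)) :
    (∑ e, ∫ x in Icc (Γ.left e) (Γ.right e), starRingEnd 𝕜 (v' e x) * u' e x) +
      ∑ e, ∫ x in Icc (Γ.left e) (Γ.right e), starRingEnd 𝕜 (v e x) * u'' e x =
      -∑ p : E × Bool, starRingEnd 𝕜 (Γ.endValue v p) * Γ.normalDeriv u' p := by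
  rw [← Finset.sum_add_distrib, Fintype.sum_prod_type, ← Finset.sum_neg_distrib]
  refine Finset.sum_congr rfl fun e _ => ?_
  rw [(hv.deriv e).conj.integral_deriv_mul_add (Γ.left_lt_right e).le (hu e), Fintype.sum_bool]
  simp only [normalDeriv, endValue, coord, if_true, Bool.false_eq_true, if_false]
  ring

open Classical in
theorem ContinuousAtVertices.sum_mul_eq_zero (hv : Γ.ContinuousAtVertices v) {n : E × Bool → 𝕜}
    (hn : ∀ w : V, ∑ p : E × Bool with Γ.vertex p = w, n p = 0) :
    ∑ p, starRingEnd 𝕜 (Γ.endValue v p) * n p = 0 := by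
  -- The endpoints are grouped by vertex, and `v` has a single value on each group. The image of
  -- `vertex` serves as the finite index set.
  rw [← Finset.sum_fiberwise_of_maps_to (t := Finset.univ.image Γ.vertex) (g := Γ.vertex)
    (fun p _ => Finset.mem_image_of_mem _ (Finset.mem_univ p))]
  refine Finset.sum_eq_zero fun w _ => ?_
  have h : ∀ p ∈ Finset.univ.filter (fun p => Γ.vertex p = w),
      starRingEnd 𝕜 (Γ.endValue v p) * n p = starRingEnd 𝕜 (Γ.vertexValue v w) * n p := by
    intro p hp
    rw [← (Finset.mem_filter.mp hp).2, Γ.vertexValue_vertex v hv]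
  rw [Finset.sum_congr rfl h, ← Finset.mul_sum, hn, mul_zero]

omit [Fintype E] in
/-- The piecewise linear function with given values at the vertices. -/
theorem exists_inFormDomain_endValue_eq (Γ : MetricGraph V E) (c : V → 𝕜) :
    ∃ v v', Γ.InFormDomain v v' ∧ ∀ p, Γ.endValue v p = c (Γ.vertex p) := by
  set k : E → 𝕜 := fun e => (c (Γ.vertex (e, true)) - c (Γ.vertex (e, false))) /
    ((Γ.right e - Γ.left e : ℝ) : 𝕜) with hk
  set v : E → ℝ → 𝕜 := fun e x => c (Γ.vertex (e, false)) + ∫ _ in Γ.left e..x, k e with hv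
  have hend : ∀ p, Γ.endValue v p = c (Γ.vertex p) := by
    rintro ⟨e, _ | _⟩
    · simp [endValue, coord, hv]
    · have h0 : ((Γ.right e - Γ.left e : ℝ) : 𝕜) ≠ 0 := by
        rw [Ne, RCLike.ofReal_eq_zero]; linarith [Γ.left_lt_right e]
      simp only [endValue, coord, hv, if_true, intervalIntegral.integral_const,
        RCLike.real_smul_eq_coe_mul, hk]
      rw [mul_div_cancel₀ _ h0]
      ring
  exact ⟨v, fun e _ => k e, ⟨fun e => HasSobolevDeriv.primitive (memLp_const _) _,
    fun p q hpq => by rw [hend, hend, hpq]⟩, hend⟩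

/-- The weak form of the equation for eigenfunctions. -/
theorem isEigenfunction_iff {μ : ℝ} : Γ.IsEigenfunction μ u ↔
    ∃ (u' : E → ℝ → 𝕜) (h : Γ.InFormDomain u u'), h.toL2 ≠ 0 ∧
      ∀ (v v' : E → ℝ → 𝕜) (hv : Γ.InFormDomain v v'),
        inner 𝕜 hv.derivL2 h.derivL2 = (μ : 𝕜) * inner 𝕜 hv.toL2 h.toL2 := by
  classical
  constructor
  · rintro ⟨h0, u', u'', hd, heq⟩
    have h : Γ.InFormDomain u u' := ⟨hd.deriv_one, hd.continuousAtVertices⟩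
    refine ⟨u', h, fun h1 => h0 (h.restrict_eq_zero_iff.mpr h1), fun v v' hv => ?_⟩
    have h2 := hv.sum_integral_add hd.deriv_two
    have h3 : ∑ p, starRingEnd 𝕜 (Γ.endValue v p) * Γ.normalDeriv u' p = 0 :=
      hv.continuousAtVertices.sum_mul_eq_zero fun w => by
        convert! hd.sum_normalDeriv w
    rw [h3, neg_zero] at h2
    rw [hv.inner_derivL2 h, hv.inner_toL2 h, eq_neg_of_add_eq_zero_left h2, Finset.mul_sum,
      ← Finset.sum_neg_distrib]
    refine Finset.sum_congr rfl fun e _ => ?_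
    rw [← integral_const_mul, ← integral_neg]
    refine integral_congr_ae ?_
    filter_upwards [heq e] with x hx
    linear_combination starRingEnd 𝕜 (v e x) * hx
  · rintro ⟨u', h, h0, hw⟩
    have key : ∀ e, ∃ w, u' e =ᵐ[volume.restrict (Icc (Γ.left e) (Γ.right e))] w ∧
        HasSobolevDeriv (Γ.left e) (Γ.right e) w fun x => -((μ : 𝕜) * u e x) := by
      intro e
      -- Test functions supported on a single edge give the differential equation there.
      refine (h.deriv e).exists_deriv_two_of_weak (Γ.left_lt_right e) μ fun v v' hv ha hb => ?_
      have hv' := inFormDomain_of_edge e hv ha hb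
      have h1 := hw _ _ hv'
      rw [hv'.inner_derivL2 h, hv'.inner_toL2 h, Finset.sum_eq_single e, Finset.sum_eq_single e]
        at h1
      · simpa using h1
      · intro e' _ he; simp [he]
      · simp
      · intro e' _ he; simp [he]
      · simp
    choose w hw1 hw2 using key
    -- Normal derivatives are pointwise values, so `u'` is replaced by its continuous representative
    -- `w`.
    have h' : Γ.InFormDomain u w := ⟨fun e => (h.deriv e).congr_deriv (hw1 e),
      h.continuousAtVertices⟩
    have hd : h.derivL2 = h'.derivL2 := Γ.toL2_ext fun e =>
      ((Γ.coeFn_toL2 h.memLp_deriv e).trans (hw1 e)).trans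
        (Γ.coeFn_toL2 h'.memLp_deriv e).symm
    refine ⟨fun h1 => h0 (h.restrict_eq_zero_iff.mp h1), w, fun e x => -((μ : 𝕜) * u e x),
      ⟨h'.deriv, hw2, h.continuousAtVertices, fun z => ?_⟩,
      fun e => .of_forall fun x => neg_neg _⟩
    -- A test function equal to one at `z` and zero at the other vertices isolates the sum of normal
    -- derivatives at `z` in Green's formula.
    obtain ⟨v, v', hv, hvc⟩ := Γ.exists_inFormDomain_endValue_eq
      (fun y => if y = z then (1 : 𝕜) else 0)
    have h1 := hw _ _ hv
    rw [hd, hv.inner_derivL2 h', hv.inner_toL2 h] at h1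
    have h2 := hv.sum_integral_add hw2
    have h3 : ∑ e, ∫ x in Icc (Γ.left e) (Γ.right e),
        starRingEnd 𝕜 (v e x) * -((μ : 𝕜) * u e x) =
        -((μ : 𝕜) * ∑ e, ∫ x in Icc (Γ.left e) (Γ.right e), starRingEnd 𝕜 (v e x) * u e x) := by
      rw [Finset.mul_sum, ← Finset.sum_neg_distrib]
      refine Finset.sum_congr rfl fun e _ => ?_
      rw [← integral_const_mul, ← integral_neg]
      congr 1
      ext x
      ring
    rw [h3, h1, add_neg_cancel, eq_comm, neg_eq_zero] at h2
    rw [Finset.sum_filter]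
    refine Eq.trans ?_ h2
    refine Finset.sum_congr rfl fun p _ => ?_
    rw [hvc]
    split_ifs <;> simp

end MetricGraph

/-! ### The two lowest eigenvalues, and the joining of vertices -/

namespace MetricGraph

variable {𝕜 : Type*} [RCLike 𝕜] {V E : Type*} [Fintype E] {Γ : MetricGraph V E}
  {u u' v v' : E → ℝ → 𝕜}

omit [Fintype E] in
theorem inFormDomain_const (Γ : MetricGraph V E) (c : 𝕜) :
    Γ.InFormDomain (fun _ _ => c) (fun _ _ => 0) :=
  ⟨fun _ => HasSobolevDeriv.const c, fun _ _ _ => rfl⟩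

theorem toL2_const (c : 𝕜) : (Γ.inFormDomain_const c).toL2 = c • Γ.oneL2 𝕜 :=
  ((Γ.inFormDomain_const c).restrict_eq_const_iff c).mp rfl

theorem derivL2_const (c : 𝕜) : (Γ.inFormDomain_const c).derivL2 = 0 := by
  refine Γ.toL2_ext fun e => (Γ.coeFn_toL2 (Γ.inFormDomain_const c).memLp_deriv e).trans ?_
  exact (Lp.coeFn_zero 𝕜 2 (Γ.edgeMeasure e)).symm

omit [Fintype E] in
theorem Connected.nonempty_point (hΓ : Γ.Connected) : Nonempty Γ.Point := by
  obtain ⟨e⟩ := hΓ.nonempty_edge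
  exact ⟨⟨e, Γ.left e, le_rfl, (Γ.left_lt_right e).le⟩⟩

theorem Connected.isEigenfunction_one (hΓ : Γ.Connected) :
    Γ.IsEigenfunction 0 fun _ _ => (1 : 𝕜) := by
  obtain ⟨p⟩ := hΓ.nonempty_point
  refine isEigenfunction_iff.mpr ⟨_, Γ.inFormDomain_const 1, ?_, fun v v' hv => ?_⟩
  · rw [Ne, ← (Γ.inFormDomain_const 1).restrict_eq_zero_iff]
    exact fun h => one_ne_zero (congrFun h p)
  · rw [derivL2_const]
    simp

theorem Connected.oneL2_ne_zero (hΓ : Γ.Connected) : Γ.oneL2 𝕜 ≠ 0 := by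
  intro h
  have h1 := toL2_const (Γ := Γ) (1 : 𝕜)
  rw [h, smul_zero, ← InFormDomain.restrict_eq_zero_iff] at h1
  exact hΓ.isEigenfunction_one.1 h1

theorem norm_sq_derivL2_of_weak {μ : ℝ} {h : Γ.InFormDomain u u'}
    (hw : ∀ (v v' : E → ℝ → 𝕜) (hv : Γ.InFormDomain v v'),
      inner 𝕜 hv.derivL2 h.derivL2 = (μ : 𝕜) * inner 𝕜 hv.toL2 h.toL2) :
    ‖h.derivL2‖ ^ 2 = μ * ‖h.toL2‖ ^ 2 := by
  have h1 := hw u u' h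
  rw [inner_self_eq_norm_sq_to_K, inner_self_eq_norm_sq_to_K] at h1
  exact_mod_cast h1

/-- Test the weak equation with the constant `1`, whose derivative vanishes. -/
theorem inner_oneL2_eq_zero_of_weak {μ : ℝ} (hμ : μ ≠ 0) {h : Γ.InFormDomain u u'}
    (hw : ∀ (v v' : E → ℝ → 𝕜) (hv : Γ.InFormDomain v v'),
      inner 𝕜 hv.derivL2 h.derivL2 = (μ : 𝕜) * inner 𝕜 hv.toL2 h.toL2) :
    inner 𝕜 (Γ.oneL2 𝕜) h.toL2 = 0 := by
  have h1 := hw _ _ (Γ.inFormDomain_const 1)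
  rw [derivL2_const, toL2_const, inner_zero_left, one_smul, eq_comm] at h1
  exact (mul_eq_zero.mp h1).resolve_left (by simpa using hμ)

theorem IsEigenfunction.nonneg {μ : ℝ} (hu : Γ.IsEigenfunction μ u) : 0 ≤ μ := by
  obtain ⟨u', h, h0, hw⟩ := isEigenfunction_iff.mp hu
  have h1 := norm_sq_derivL2_of_weak hw
  have h2 : 0 < ‖h.toL2‖ ^ 2 := by have := norm_pos_iff.mpr h0; positivity
  by_contra hμ
  nlinarith [sq_nonneg ‖h.derivL2‖]

/-- The eigenfunctions with eigenvalue zero are constant. -/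
theorem IsEigenfunction.exists_restrict_eq_const (hΓ : Γ.Connected)
    (hu : Γ.IsEigenfunction 0 u) : ∃ r : 𝕜, Γ.restrict u = fun _ => r := by
  obtain ⟨u', h, h0, hw⟩ := isEigenfunction_iff.mp hu
  have h1 := norm_sq_derivL2_of_weak hw
  rw [zero_mul, sq_eq_zero_iff, norm_eq_zero] at h1
  obtain ⟨r, hr⟩ := h.exists_toL2_eq hΓ
  refine ⟨r, (h.restrict_eq_const_iff r).mpr ?_⟩
  have h2 : (⟨h.derivL2, h.derivL2_mem⟩ : Γ.derivSpace 𝕜) = 0 := Subtype.ext h1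
  rw [hr, h2, map_zero, zero_add]

theorem isLeast_levels_one (𝕜 : Type*) [RCLike 𝕜] (hΓ : Γ.Connected) :
    IsLeast (Γ.levels 𝕜 1) 0 := by
  constructor
  · refine ⟨fun _ _ _ => 1, ?_, fun _ => ⟨0, le_rfl, hΓ.isEigenfunction_one⟩⟩
    rw [linearIndependent_unique_iff]
    exact hΓ.isEigenfunction_one.1
  · rintro t ⟨u, -, hu⟩
    obtain ⟨μ, hμ, h⟩ := hu 0
    exact h.nonneg.trans hμ

/-- The constant `1` and `u` are orthogonal, hence independent, so `l` is a level. Below `l` the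
only eigenvalue is zero: any other has eigenfunctions of mean zero, and `hmin` forces it to be at
least `l`. Its eigenfunctions are constants, and no two of these are independent. -/
theorem isLeast_levels_two (hΓ : Γ.Connected) {l : ℝ} (hl : 0 < l)
    (hmin : ∀ (u u' : E → ℝ → 𝕜) (h : Γ.InFormDomain u u'), inner 𝕜 (Γ.oneL2 𝕜) h.toL2 = 0 →
      l * ‖h.toL2‖ ^ 2 ≤ ‖h.derivL2‖ ^ 2) (hu : Γ.IsEigenfunction l u) :
    IsLeast (Γ.levels 𝕜 2) l := by
  constructor
  · refine ⟨![fun _ _ => 1, u], ?_, ?_⟩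
    · have h1 : (fun i => Γ.restrict ((![fun _ _ => 1, u] : Fin 2 → E → ℝ → 𝕜) i)) =
          ![Γ.restrict fun _ _ => (1 : 𝕜), Γ.restrict u] := by
        ext i p
        fin_cases i <;> rfl
      rw [h1, LinearIndependent.pair_iff' hΓ.isEigenfunction_one.1]
      intro c hc
      obtain ⟨u', h, h0, hw⟩ := isEigenfunction_iff.mp hu
      have h2 := (h.restrict_eq_const_iff c).mp
        (by rw [← hc]; ext p; simp [restrict])
      have h3 := inner_oneL2_eq_zero_of_weak hl.ne' hw
      rw [h2, inner_smul_right, mul_eq_zero, inner_self_eq_zero] at h3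
      have hc0 := h3.resolve_right hΓ.oneL2_ne_zero
      exact h0 (by rw [h2, hc0, zero_smul])
    · intro i
      fin_cases i
      · exact ⟨0, hl.le, hΓ.isEigenfunction_one⟩
      · exact ⟨l, le_rfl, hu⟩
  · rintro t ⟨w, hli, hw⟩
    by_contra! ht
    have key : ∀ i, ∃ r : 𝕜, Γ.restrict (w i) = fun _ => r := by
      intro i
      obtain ⟨μ, hμ, h⟩ := hw i
      obtain rfl | hμ0 := eq_or_ne μ 0
      · exact h.exists_restrict_eq_const hΓ
      · obtain ⟨u', hd, h0, hweak⟩ := isEigenfunction_iff.mp h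
        have h1 := hmin _ _ hd (inner_oneL2_eq_zero_of_weak hμ0 hweak)
        rw [norm_sq_derivL2_of_weak hweak] at h1
        have h2 : 0 < ‖hd.toL2‖ ^ 2 := by have := norm_pos_iff.mpr h0; positivity
        have h3 := le_of_mul_le_mul_right h1 h2
        linarith
    choose r hr using key
    have h1 := (LinearIndependent.pair_iff (x := Γ.restrict (w 0)) (y := Γ.restrict (w 1))
      (R := 𝕜)).mp (by convert! hli using 1; ext i p; fin_cases i <;> rfl) (r 1) (-r 0) (by
        rw [hr 0, hr 1]; ext p; simp [mul_comm])
    refine hli.ne_zero 1 ?_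
    rw [hr 1, h1.1]
    rfl

omit [Fintype E] in
theorem Connected.glue (hΓ : Γ.Connected) (V₁ V₂ : V) : (Γ.glue V₁ V₂).Connected := by
  obtain ⟨⟨v₀⟩, h⟩ := hΓ
  refine ⟨⟨Quot.mk _ v₀⟩, ?_⟩
  rintro ⟨x⟩ ⟨y⟩
  induction h x y with
  | rel x y hxy =>
    obtain ⟨e, rfl, rfl⟩ := hxy
    exact .rel _ _ ⟨e, rfl, rfl⟩
  | refl => exact .refl _
  | symm _ _ _ ih => exact ih.symm
  | trans _ _ _ _ _ ih1 ih2 => exact ih1.trans _ _ _ ih2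

-- When the values at `V₁` and `V₂` agree, `vertexValue` descends to the quotient, which gives
-- continuity at the joined vertex.
omit [RCLike 𝕜] [Fintype E] in
theorem continuousAtVertices_glue_iff {V₁ V₂ : V} :
    (Γ.glue V₁ V₂).ContinuousAtVertices u ↔
      Γ.ContinuousAtVertices u ∧ Γ.vertexValue u V₁ = Γ.vertexValue u V₂ := by
  constructor
  · intro h
    have h1 : Γ.ContinuousAtVertices u := fun p q hpq =>
      h p q (congrArg (Quot.mk fun x y : V => x = V₁ ∧ y = V₂) hpq)
    refine ⟨h1, ?_⟩
    obtain ⟨p, rfl⟩ := Γ.vertex_surjective V₁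
    obtain ⟨q, rfl⟩ := Γ.vertex_surjective V₂
    rw [Γ.vertexValue_vertex u h1, Γ.vertexValue_vertex u h1]
    exact h p q (Quot.sound ⟨rfl, rfl⟩)
  · rintro ⟨h1, h2⟩ p q hpq
    have h3 := congrArg (Quot.lift (Γ.vertexValue u)
      (by rintro x y ⟨rfl, rfl⟩; exact h2)) hpq
    change Γ.vertexValue u (Γ.vertex p) = Γ.vertexValue u (Γ.vertex q) at h3
    rwa [Γ.vertexValue_vertex u h1, Γ.vertexValue_vertex u h1] at h3

-- The heart of the comparison: joining vertices imposes one linear constraint on the form domain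
-- and changes nothing else.
omit [Fintype E] in
theorem inFormDomain_glue_iff {V₁ V₂ : V} :
    (Γ.glue V₁ V₂).InFormDomain u u' ↔
      Γ.InFormDomain u u' ∧ Γ.vertexValue u V₁ = Γ.vertexValue u V₂ :=
  ⟨fun h => ⟨⟨h.deriv, (continuousAtVertices_glue_iff.mp h.2).1⟩,
      (continuousAtVertices_glue_iff.mp h.2).2⟩,
    fun h => ⟨h.1.deriv, continuousAtVertices_glue_iff.mpr ⟨h.1.2, h.2⟩⟩⟩

/-- An eigenfunction with equal values at two vertices remains one when these are joined. -/
theorem IsEigenfunction.glue {μ : ℝ} {V₁ V₂ : V} (hu : Γ.IsEigenfunction μ u)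
    (h12 : Γ.vertexValue u V₁ = Γ.vertexValue u V₂) : (Γ.glue V₁ V₂).IsEigenfunction μ u := by
  obtain ⟨u', h, h0, hw⟩ := isEigenfunction_iff.mp hu
  refine isEigenfunction_iff.mpr ⟨u', inFormDomain_glue_iff.mpr ⟨h, h12⟩, h0, fun v v' hv => ?_⟩
  -- The joined graph has fewer test functions, so the weak equation on `Γ` already covers them.
  exact hw v v' (inFormDomain_glue_iff.mp hv).1

end MetricGraph
end

theorem theorem1 {𝕜 : Type*} [RCLike 𝕜] {V E : Type*} [Fintype E] (Γ : MetricGraph V E)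
    (hΓ : Γ.Connected) (V₁ V₂ : V) :
    -- the eigenvalues involved exist, the lowest is zero, and the spectral gap is `λ₁`
    (∀ k ≤ 1, IsLeast (Γ.levels 𝕜 (k + 1)) (Γ.eigenvalue 𝕜 k)) ∧
    (∀ k ≤ 1, IsLeast ((Γ.glue V₁ V₂).levels 𝕜 (k + 1)) ((Γ.glue V₁ V₂).eigenvalue 𝕜 k)) ∧
    Γ.spectralGap 𝕜 = Γ.eigenvalue 𝕜 1 ∧
    (Γ.glue V₁ V₂).spectralGap 𝕜 = (Γ.glue V₁ V₂).eigenvalue 𝕜 1 ∧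
    -- the inequality
    Γ.eigenvalue 𝕜 1 ≤ (Γ.glue V₁ V₂).eigenvalue 𝕜 1 ∧
    -- the case of equality
    (Γ.eigenvalue 𝕜 1 = (Γ.glue V₁ V₂).eigenvalue 𝕜 1 ↔
      ∃ ψ : E → ℝ → 𝕜, Γ.IsEigenfunction (Γ.eigenvalue 𝕜 1) ψ ∧
        Γ.vertexValue ψ V₁ = Γ.vertexValue ψ V₂) := by
  have hΓ' := hΓ.glue V₁ V₂
  obtain ⟨l, hl, hmin, heq, u, u', h, hu1, hu0, hu⟩ :=
    MetricGraph.exists_rayleigh_minimum 𝕜 hΓ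
  obtain ⟨l', hl', hmin', heq', w, w', h', hw1, hw0, hw⟩ :=
    MetricGraph.exists_rayleigh_minimum 𝕜 hΓ'
  have h1 := MetricGraph.isLeast_levels_one 𝕜 hΓ
  have h1' := MetricGraph.isLeast_levels_one 𝕜 hΓ'
  have h2 := MetricGraph.isLeast_levels_two hΓ hl hmin
    (MetricGraph.isEigenfunction_iff.mpr ⟨u', h, hu0, heq u u' h hu1 hu⟩)
  have h2' := MetricGraph.isLeast_levels_two hΓ' hl' hmin'
    (MetricGraph.isEigenfunction_iff.mpr ⟨w', h', hw0, heq' w w' h' hw1 hw⟩)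
  have e0 : Γ.eigenvalue 𝕜 0 = 0 := h1.csInf_eq
  have e0' : (Γ.glue V₁ V₂).eigenvalue 𝕜 0 = 0 := h1'.csInf_eq
  have e1 : Γ.eigenvalue 𝕜 1 = l := h2.csInf_eq
  have e1' : (Γ.glue V₁ V₂).eigenvalue 𝕜 1 = l' := h2'.csInf_eq
  obtain ⟨hΓw, hw12⟩ := MetricGraph.inFormDomain_glue_iff.mp h'
  have hle : l ≤ l' := by
    -- The minimizer of the joined graph competes on `Γ`. Both graphs have the same edges, so the
    -- `L₂` spaces, norms and means coincide definitionally.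
    have h3 : l * ‖h'.toL2‖ ^ 2 ≤ ‖h'.derivL2‖ ^ 2 := hmin w w' hΓw hw1
    rw [hw] at h3
    have h4 : 0 < ‖h'.toL2‖ ^ 2 := by have := norm_pos_iff.mpr hw0; positivity
    exact le_of_mul_le_mul_right h3 h4
  refine ⟨fun k hk => ?_, fun k hk => ?_, ?_, ?_, ?_, ?_⟩
  · interval_cases k
    · rw [e0]; exact h1
    · rw [e1]; exact h2
  · interval_cases k
    · rw [e0']; exact h1'
    · rw [e1']; exact h2'
  · rw [MetricGraph.spectralGap, e0, sub_zero]
  · rw [MetricGraph.spectralGap, e0', sub_zero]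
  · rw [e1, e1']; exact hle
  · rw [e1, e1']
    constructor
    · rintro rfl
      -- With equal minima, `w` attains the minimum on `Γ` too, so `heq` gives the weak equation
      -- against all test functions of `Γ`, including those with different values at `V₁` and `V₂`.
      exact ⟨w, MetricGraph.isEigenfunction_iff.mpr ⟨w', hΓw, hw0, heq w w' hΓw hw1 hw⟩, hw12⟩
    · rintro ⟨ψ, hψ, hψ12⟩
      refine le_antisymm hle ?_
      obtain ⟨ψ', hd, h0, hweak⟩ := MetricGraph.isEigenfunction_iff.mp (hψ.glue hψ12)
      -- `ψ` has mean zero because `l ≠ 0`, so it competes on the joined graph with Rayleigh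
      -- quotient `l`.
      have h3 := hmin' _ _ hd (MetricGraph.inner_oneL2_eq_zero_of_weak hl.ne' hweak)
      rw [MetricGraph.norm_sq_derivL2_of_weak hweak] at h3
      have h4 : 0 < ‖hd.toL2‖ ^ 2 := by have := norm_pos_iff.mpr h0; positivity
      exact le_of_mul_le_mul_right h3 h4
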